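/- Theorem 4.3. Let $n$ be a positive integer, let $E_n$ be the elliptic curve $y^2 = x^3 - n^2 x$ over $\mathbb{C}$ with $O$ its point at infinity, let $M$ denote the arithmetic–geometric mean, let $G = 1/M(\sqrt2, 1)$ be Gauss's constant, and let $$\Lambda = \frac{\pi}{\sqrt n}\, G\, \mathbb{Z}[i] \subset \mathbb{C}.$$ Then $\mathbb{C}/\Lambda \cong E_n(\mathbb{C})$. More precisely, with $\wp$ the Weierstrass function of the lattice $\Lambda$, the map $$z \longmapsto \begin{cases} \left(\wp(z), \tfrac12 \wp'(z)\right), & z \notin \Lambda, \\ O, & z \in \Lambda, \end{cases}$$ induces an isomorphism of complex Lie groups $\mathbb{C}/\Lambda \to E_n(\mathbb{C})$, i.e. an isomorphism of groups that is biholomorphic. -/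

import Mathlib

open scoped LinearAlgebra.Projectivization Topology

noncomputable section

/-- The curve `y² = x³ - n² x` over `ℂ`. -/
def congruentCurve (n : ℕ) : WeierstrassCurve.Affine ℂ where
  a₁ := 0
  a₂ := 0
  a₃ := 0
  a₄ := -(n : ℂ) ^ 2
  a₆ := 0

/-- For `n > 0` the curve `y² = x³ - n² x` is an elliptic curve. -/
theorem congruentCurve_isElliptic {n : ℕ} (hn : 0 < n) :
    WeierstrassCurve.IsElliptic (congruentCurve n) := by
  have h : (n : ℂ) ≠ 0 := by exact_mod_cast hn.ne'
  refine ⟨?_⟩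
  have e : WeierstrassCurve.Δ (congruentCurve n) = 64 * (n : ℂ) ^ 6 := by
    simp only [WeierstrassCurve.Δ, WeierstrassCurve.b₂, WeierstrassCurve.b₄, WeierstrassCurve.b₆,
      WeierstrassCurve.b₈, congruentCurve]
    ring
  rw [e]
  exact (mul_ne_zero (by norm_num) (pow_ne_zero _ h)).isUnit

/-- Gauss's constant `G = 1 / M(√2, 1)`, with `M` the arithmetic-geometric mean. -/
def gaussConstant : ℝ := 1 / (NNReal.agm (NNReal.sqrt 2) 1 : ℝ)

/-- The real number `(π / √n) G`. -/
def congruentPeriod (n : ℕ) : ℝ := Real.pi / √(n : ℝ) * gaussConstant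

theorem congruentPeriod_pos {n : ℕ} (hn : 0 < n) : 0 < congruentPeriod n := by
  have h2 : 0 < NNReal.agm (NNReal.sqrt 2) 1 := NNReal.agm_pos (by simp) one_pos
  have h3 : (0 : ℝ) < (NNReal.agm (NNReal.sqrt 2) 1 : ℝ) := by exact_mod_cast h2
  have h4 : (0 : ℝ) < (n : ℝ) := by exact_mod_cast hn
  unfold congruentPeriod gaussConstant
  positivity

/-- The subgroup `(π / √n) G ℤ[i]` of `ℂ`. -/
def congruentLattice (n : ℕ) : AddSubgroup ℂ :=
  AddSubgroup.map (AddMonoidHom.mulLeft (congruentPeriod n : ℂ))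
    GaussianInt.toComplex.toAddMonoidHom.range

/-- The pair of periods `c, i c` with `c = (π / √n) G`; it is used to access the Weierstrass
functions of the lattice `(π / √n) G ℤ[i]`. -/
def congruentPeriodPair (n : ℕ) (hn : 0 < n) : PeriodPair where
  ω₁ := (congruentPeriod n : ℂ)
  ω₂ := Complex.I * (congruentPeriod n : ℂ)
  indep := by
    have hc := (congruentPeriod_pos hn).ne'
    rw [LinearIndependent.pair_iff]
    intro s t h
    have hre := congrArg Complex.re h
    have him := congrArg Complex.im h
    simp at hre him
    exact ⟨hre.resolve_right hc, him.resolve_right hc⟩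

theorem congruentPeriodPair_lattice (n : ℕ) (hn : 0 < n) :
    (congruentPeriodPair n hn).lattice.toAddSubgroup = congruentLattice n := by
  ext z
  simp only [Submodule.mem_toAddSubgroup, PeriodPair.mem_lattice, congruentLattice,
    AddSubgroup.mem_map, AddMonoidHom.mem_range, congruentPeriodPair]
  constructor
  · rintro ⟨a, b, rfl⟩
    refine ⟨_, ⟨⟨a, b⟩, rfl⟩, ?_⟩
    simp [GaussianInt.toComplex_def]
    ring
  · rintro ⟨_, ⟨w, rfl⟩, rfl⟩
    refine ⟨w.re, w.im, ?_⟩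
    simp [GaussianInt.toComplex_def]
    ring

/-- The complex projective plane. -/
abbrev ProjPlane : Type := ℙ ℂ (Fin 3 → ℂ)

/-- The quotient topology on the complex projective plane. -/
instance projPlaneTopology : TopologicalSpace ProjPlane :=
  TopologicalSpace.coinduced (Projectivization.mk' ℂ : {v : Fin 3 → ℂ // v ≠ 0} → ProjPlane)
    inferInstance

/-- A function on the projective plane is holomorphic at a point `p` if, as a function of
homogeneous coordinates, it is analytic at the vectors that represent `p`
(the value at the zero vector is irrelevant). -/
def ProjPlane.HolomorphicAt (F : ProjPlane → ℂ) (p : ProjPlane) : Prop :=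
  ∀ (v : Fin 3 → ℂ) (hv : v ≠ 0), Projectivization.mk ℂ v hv = p →
    AnalyticAt ℂ (fun w => open Classical in
      if hw : w ≠ 0 then F (Projectivization.mk ℂ w hw) else 0) v

namespace WeierstrassCurve.Affine.Point

variable {W : WeierstrassCurve.Affine ℂ}

/-- The embedding of the points of a Weierstrass curve in the projective plane,
`(x, y) ↦ [x : y : 1]`, with the point at infinity going to `[0 : 1 : 0]`. -/
def toPlane : W.Point → ProjPlane
  | .zero => Projectivization.mk ℂ ![0, 1, 0] (fun h => one_ne_zero (congrFun h 1))
  | .some x y _ => Projectivization.mk ℂ ![x, y, 1] (fun h => one_ne_zero (congrFun h 2))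

/-- The complex topology on the points of a Weierstrass curve: the subspace topology of the
projective plane. -/
instance complexTopology : TopologicalSpace W.Point :=
  TopologicalSpace.induced toPlane inferInstance

/-- A function on the points of a Weierstrass curve is holomorphic at `P` if near `P` it is the
restriction of a function on the projective plane that is holomorphic at `P`. -/
def HolomorphicAt (g : W.Point → ℂ) (P : W.Point) : Prop :=
  ∃ F : ProjPlane → ℂ, ProjPlane.HolomorphicAt F P.toPlane ∧
    g =ᶠ[𝓝 P] fun Q => F Q.toPlane

end WeierstrassCurve.Affine.Point

/-- A function on `ℂ ⧸ Λ` is holomorphic at `p` if the `Λ`-periodic function on `ℂ` that it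
induces is analytic at the points above `p`. -/
def QuotientHolomorphicAt {Λ : AddSubgroup ℂ} (g : ℂ ⧸ Λ → ℂ) (p : ℂ ⧸ Λ) : Prop :=
  ∀ z : ℂ, (z : ℂ ⧸ Λ) = p → AnalyticAt ℂ (fun w : ℂ => g (w : ℂ ⧸ Λ)) z

/-- An isomorphism of complex analytic spaces from `ℂ ⧸ Λ` to a nonsingular Weierstrass curve: a
homeomorphism under which the holomorphic functions on both sides correspond. -/
structure IsBiholomorphic {Λ : AddSubgroup ℂ} {W : WeierstrassCurve.Affine ℂ}
    (φ : ℂ ⧸ Λ → W.Point) : Prop where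
  isHomeomorph : IsHomeomorph φ
  holomorphicAt_iff : ∀ (g : W.Point → ℂ) (p : ℂ ⧸ Λ),
    WeierstrassCurve.Affine.Point.HolomorphicAt g (φ p) ↔ QuotientHolomorphicAt (g ∘ φ) p

end

/-! ### Differential equations, fibres and surjectivity of `℘`. -/

namespace PeriodPair

open Filter Set

variable (L : PeriodPair)

/-! For a lattice Λ the map z ↦ (℘ z, ℘' z / 2) carries (ℂ ∖ Λ)/Λ bijectively to the affine curve y²
= x³ - (g₂/4) x - g₃/4. Injectivity is uniqueness for the equation ℘'' = 6℘² - g₂/2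
(`sub_mem_lattice_of_eq`). Surjectivity is Liouville's theorem for 1/(℘ - a)
(`exists_weierstrassP_eq`), together with the parity of ℘ and ℘'. Additivity comes from the chord
through the points with parameters t and c - t: the x-coordinate of the sum has derivative 0 in t
and tends to ℘(c) as t → 0 (`weierstrassP_add`, `derivWeierstrassP_add`).

The constant in Λ matters only for g₂ = 4n² and g₃ = 0. Multiplication by i preserves a square
lattice with side c, which forces g₃ = 0 and g₂ = 4e² with e = ℘(c/2). The substitution t = √(℘(s) -
e) writes c/2 as a complete elliptic integral (`agmIntegral_eq_half`), which Gauss's invariance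
under the two means evaluates to π / (2 √e M(√2, 1)) (`agmIntegral_eq`). The given c then yields e =
n.

For the complex structure, the map lifts locally to an analytic map into ℂ³ ∖ 0 for which some ratio
of coordinates is a local parameter (`exists_analyticAt_lift`). The lift gives continuity and pulls
holomorphic functions back; inverting the ratio pushes them forward. Compactness of ℂ/Λ makes the
bijection a homeomorphism. -/

lemma countable_lattice : (L.lattice : Set ℂ).Countable :=
  countable_of_Lindelof_of_discrete (X := L.lattice)

lemma isOpen_compl_lattice : IsOpen ((L.lattice : Set ℂ)ᶜ) := L.isClosed_lattice.isOpen_compl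

lemma isPreconnected_compl_lattice : IsPreconnected ((L.lattice : Set ℂ)ᶜ) :=
  (L.countable_lattice.isConnected_compl_of_one_lt_rank
    (Complex.rank_real_complex ▸ Nat.one_lt_ofNat)).isPreconnected

lemma eventually_notMem_lattice (z : ℂ) : ∀ᶠ w in 𝓝[≠] z, w ∉ L.lattice := by
  filter_upwards [mem_nhdsWithin_of_mem_nhds (L.compl_lattice_sdiff_singleton_mem_nhds z),
    self_mem_nhdsWithin] with w hw hwz hwL
  exact hw ⟨hwL, hwz⟩

lemma tendsto_weierstrassP_cobounded {l : ℂ} (hl : l ∈ L.lattice) :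
    Tendsto L.weierstrassP (𝓝[≠] l) (Bornology.cobounded ℂ) :=
  tendsto_cobounded_of_meromorphicOrderAt_neg (by rw [L.order_weierstrassP l hl]; decide)

lemma analyticAt_weierstrassP {z : ℂ} (hz : z ∉ L.lattice) : AnalyticAt ℂ L.weierstrassP z :=
  L.analyticOnNhd_weierstrassP z hz

lemma analyticAt_derivWeierstrassP {z : ℂ} (hz : z ∉ L.lattice) :
    AnalyticAt ℂ L.derivWeierstrassP z :=
  L.analyticOnNhd_derivWeierstrassP z hz

lemma hasDerivAt_weierstrassP {z : ℂ} (hz : z ∉ L.lattice) :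
    HasDerivAt L.weierstrassP (L.derivWeierstrassP z) z := by
  rw [← L.deriv_weierstrassP]
  exact (L.analyticAt_weierstrassP hz).differentiableAt.hasDerivAt

/-- `℘` is not constant on the complement of the lattice. -/
lemma not_eqOn_weierstrassP_const (a : ℂ) : ¬ ∀ z ∉ L.lattice, L.weierstrassP z = a := by
  intro h
  have h1 : Tendsto (fun _ : ℂ ↦ a) (𝓝[≠] 0) (Bornology.cobounded ℂ) :=
    (L.tendsto_weierstrassP_cobounded L.lattice.zero_mem).congr' (by
      filter_upwards [L.eventually_notMem_lattice 0] with z hz using h z hz)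
  have h2 := h1.eventually (Bornology.eventually_ne_cobounded a)
  exact h2.exists.elim fun _ h ↦ h rfl

lemma not_eqOn_derivWeierstrassP_zero : ¬ ∀ z ∉ L.lattice, L.derivWeierstrassP z = 0 := by
  intro h
  obtain ⟨a, ha⟩ := L.isOpen_compl_lattice.exists_is_const_of_deriv_eq_zero
    L.isPreconnected_compl_lattice L.differentiableOn_weierstrassP
    (fun z hz ↦ by simpa using h z hz)
  exact L.not_eqOn_weierstrassP_const a ha

/-- The second-order differential equation `℘'' = 6 ℘² - g₂ / 2`. -/
lemma hasDerivAt_derivWeierstrassP {z : ℂ} (hz : z ∉ L.lattice) :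
    HasDerivAt L.derivWeierstrassP (6 * L.weierstrassP z ^ 2 - L.g₂ / 2) z := by
  -- Differentiating the cubic relation gives ℘' · (℘'' - 6℘² + g₂/2) = 0. On the connected
  -- complement of Λ one factor vanishes identically, and it is not ℘'.
  have key := AnalyticOnNhd.eq_zero_or_eq_zero_of_mul_eq_zero (𝕜 := ℂ) (U := (L.lattice : Set ℂ)ᶜ)
    (f := L.derivWeierstrassP)
    (g := fun z ↦ deriv L.derivWeierstrassP z - (6 * L.weierstrassP z ^ 2 - L.g₂ / 2))
    L.analyticOnNhd_derivWeierstrassP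
    (fun w hw ↦ by
      have h1 := (L.analyticAt_derivWeierstrassP hw).deriv
      have h2 := L.analyticAt_weierstrassP hw
      fun_prop)
    (fun w hw ↦ by
      have h1 := (L.analyticAt_derivWeierstrassP hw).differentiableAt.hasDerivAt
      have h2 := L.hasDerivAt_weierstrassP hw
      have h3 := (h1.fun_pow 2).congr_of_eventuallyEq (f₁ := fun z ↦
          4 * L.weierstrassP z ^ 3 - L.g₂ * L.weierstrassP z - L.g₃) (by
        filter_upwards [L.isOpen_compl_lattice.mem_nhds hw] with v hv
        exact (L.derivWeierstrassP_sq v hv).symm)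
      have h4 := (((h2.fun_pow 3).const_mul 4).sub (h2.const_mul L.g₂)).sub_const L.g₃
      have h5 := h3.unique h4
      push_cast at h5
      linear_combination h5 / 2)
    L.isPreconnected_compl_lattice
  have h0 := key.resolve_left (fun h ↦ L.not_eqOn_derivWeierstrassP_zero h) z hz
  rw [← sub_eq_zero.mp h0]
  exact (L.analyticAt_derivWeierstrassP hz).differentiableAt.hasDerivAt

/-- A point of `ℂ ∖ Λ` is determined modulo `Λ` by the values of `℘` and `℘'`. -/
lemma sub_mem_lattice_of_eq {p q : ℂ} (hp : p ∉ L.lattice) (hq : q ∉ L.lattice)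
    (h : L.weierstrassP p = L.weierstrassP q)
    (h' : L.derivWeierstrassP p = L.derivWeierstrassP q) : p - q ∈ L.lattice := by
  set τ : ℂ := p - q with hτ
  have hq' : p - τ = q := by simp [hτ]
  have hτL : p - τ ∉ L.lattice := by rwa [hq']
  have ev : ∀ᶠ z in 𝓝 p, z ∉ L.lattice ∧ z - τ ∉ L.lattice := by
    refine (show ∀ᶠ z in 𝓝 p, z ∉ L.lattice from L.isOpen_compl_lattice.mem_nhds hp).and ?_
    have hc : ContinuousAt (fun z : ℂ ↦ z - τ) p := by fun_prop
    exact hc.eventually (L.isOpen_compl_lattice.mem_nhds hτL)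
  set d : ℂ → ℂ := fun z ↦ L.weierstrassP z - L.weierstrassP (z - τ) with hd
  have shift : AnalyticAt ℂ (fun z : ℂ ↦ z - τ) p := by fun_prop
  have a1 := L.analyticAt_weierstrassP hp
  have a2 : AnalyticAt ℂ (fun z ↦ L.weierstrassP (z - τ)) p :=
    (L.analyticAt_weierstrassP hτL).fun_comp_of_eq shift rfl
  have hda : AnalyticAt ℂ d p := a1.sub a2
  have d1 : deriv d =ᶠ[𝓝 p] fun z ↦ L.derivWeierstrassP z - L.derivWeierstrassP (z - τ) := by
    filter_upwards [ev] with z hz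
    exact ((L.hasDerivAt_weierstrassP hz.1).sub
      ((L.hasDerivAt_weierstrassP hz.2).comp_sub_const z τ)).deriv
  have d2 : deriv (deriv d) =ᶠ[𝓝 p]
      fun z ↦ (6 * (L.weierstrassP z + L.weierstrassP (z - τ))) * d z := by
    filter_upwards [ev, d1.eventuallyEq_nhds] with z hz hz1
    rw [hz1.deriv_eq]
    refine ((L.hasDerivAt_derivWeierstrassP hz.1).sub
      ((L.hasDerivAt_derivWeierstrassP hz.2).comp_sub_const z τ)).deriv.trans ?_
    simp only [hd]; ring
  have dp : d p = 0 := by simp [hd, hq', h]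
  have dp1 : deriv d p = 0 := by rw [d1.eq_of_nhds]; simp [hq', h']
  -- Uniqueness for the linear equation d'' = 6(℘(z) + ℘(z - τ)) d with d(p) = d'(p) = 0: a finite
  -- order m at p would drop to m - 2 for d'', while the equation makes it at least m.
  have top : analyticOrderAt d p = ⊤ := by
    by_contra hne
    obtain ⟨m, hm⟩ := ENat.ne_top_iff_exists.mp hne
    have o1 : analyticOrderAt (deriv d) p + 1 = analyticOrderAt d p := by
      simpa [dp] using hda.analyticOrderAt_deriv_add_one
    have o2 : analyticOrderAt (deriv (deriv d)) p + 1 = analyticOrderAt (deriv d) p := by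
      simpa [dp1] using hda.deriv.analyticOrderAt_deriv_add_one
    have o3 : analyticOrderAt d p ≤ analyticOrderAt (deriv (deriv d)) p := by
      rw [analyticOrderAt_congr d2]
      have ha : AnalyticAt ℂ (fun z ↦ 6 * (L.weierstrassP z + L.weierstrassP (z - τ))) p := by
        fun_prop
      have := analyticOrderAt_mul ha hda
      simp only [Pi.mul_def] at this
      rw [this]
      exact le_add_self
    rw [← o2, ← hm] at o1
    rw [← hm] at o3
    generalize analyticOrderAt (deriv (deriv d)) p = k at o1 o3
    have hk : k ≠ ⊤ := by rintro rfl; simp at o1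
    obtain ⟨k, rfl⟩ := ENat.ne_top_iff_exists.mp hk
    norm_cast at o1 o3
    omega
  -- spread the equality to the complement of `Λ ∪ (Λ + τ)`
  set V : Set ℂ := ((L.lattice : Set ℂ) ∪ (fun z ↦ z - τ) ⁻¹' (L.lattice : Set ℂ))ᶜ with hV
  have cV : IsPreconnected V := by
    refine (Set.Countable.isConnected_compl_of_one_lt_rank
      (Complex.rank_real_complex ▸ Nat.one_lt_ofNat) ?_).isPreconnected
    exact L.countable_lattice.union (L.countable_lattice.preimage sub_left_injective)
  have hpV : p ∈ V := by simp [hV, hp, hq, hq']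
  have hdV : AnalyticOnNhd ℂ d V := by
    intro z hz
    simp only [hV, mem_compl_iff, mem_union, not_or, mem_preimage, SetLike.mem_coe] at hz
    exact (L.analyticAt_weierstrassP hz.1).sub
      ((L.analyticAt_weierstrassP hz.2).fun_comp_of_eq (by fun_prop) rfl)
  have hzero := hdV.eqOn_zero_of_preconnected_of_eventuallyEq_zero cV hpV
    (analyticOrderAt_eq_top.mp top)
  -- If τ ∉ Λ, then ℘(z - τ) is continuous at 0 and agrees with ℘ near 0, where ℘ has a pole.
  by_contra hτΛ
  have t1 : Tendsto L.weierstrassP (𝓝[≠] 0) (𝓝 (L.weierstrassP (0 - τ))) := by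
    have hτ' : (0 : ℂ) - τ ∉ L.lattice := by simpa using hτΛ
    have c1 : ContinuousAt (fun z ↦ L.weierstrassP (z - τ)) 0 :=
      ((L.analyticAt_weierstrassP hτ').fun_comp_of_eq
        (f := fun z : ℂ ↦ z - τ) (by fun_prop) rfl).continuousAt
    refine (c1.tendsto.mono_left nhdsWithin_le_nhds).congr' ?_
    have hc : ContinuousAt (fun z : ℂ ↦ z - τ) 0 := by fun_prop
    filter_upwards [L.eventually_notMem_lattice 0, mem_nhdsWithin_of_mem_nhds
      (hc.eventually (L.isOpen_compl_lattice.mem_nhds hτ'))] with z hz hz'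
    have := hzero (x := z) (by simpa [hV] using ⟨hz, hz'⟩)
    simp only [hd, Pi.zero_apply, sub_eq_zero] at this
    exact this.symm
  exact not_tendsto_nhds_of_tendsto_atTop (tendsto_norm_atTop_iff_cobounded.mpr
    (L.tendsto_weierstrassP_cobounded L.lattice.zero_mem)) _ t1.norm

/-- `℘ : ℂ ∖ Λ → ℂ` is surjective. -/
lemma exists_weierstrassP_eq (a : ℂ) : ∃ z ∉ L.lattice, L.weierstrassP z = a := by
  classical
  by_contra! hne
  -- If a is omitted, 1/(℘ - a), extended by 0 at the poles, is entire and periodic, hence bounded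
  -- and constant. It vanishes on Λ but nowhere else.
  set g : ℂ → ℂ := fun z ↦ if z ∈ L.lattice then 0 else (L.weierstrassP z - a)⁻¹ with hg
  have gan : ∀ z ∉ L.lattice, AnalyticAt ℂ g z := by
    intro z hz
    refine AnalyticAt.congr (f := fun z ↦ (L.weierstrassP z - a)⁻¹) ?_ ?_
    · exact ((L.analyticAt_weierstrassP hz).sub analyticAt_const).fun_inv
        (sub_ne_zero.mpr (hne z hz))
    · filter_upwards [L.isOpen_compl_lattice.mem_nhds hz] with w hw
      simp only [mem_compl_iff, SetLike.mem_coe] at hw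
      simp [hg, hw]
  have hdiff : Differentiable ℂ g := by
    intro z
    by_cases hz : z ∈ L.lattice
    · refine (Complex.analyticAt_of_differentiable_on_punctured_nhds_of_continuousAt ?_
        ?_).differentiableAt
      · filter_upwards [L.eventually_notMem_lattice z] with w hw using (gan w hw).differentiableAt
      · rw [continuousAt_iff_punctured_nhds]
        have h0 : g z = 0 := by simp [hg, hz]
        rw [h0]
        have t : Tendsto (fun w ↦ L.weierstrassP w - a) (𝓝[≠] z) (Bornology.cobounded ℂ) := by
          simpa [sub_eq_add_neg, Function.comp_def] using (tendsto_add_const_cobounded (-a)).comp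
            (L.tendsto_weierstrassP_cobounded hz)
        refine (tendsto_inv₀_cobounded.comp t).congr' ?_
        filter_upwards [L.eventually_notMem_lattice z] with w hw
        simp [hg, hw]
    · exact (gan z hz).differentiableAt
  have hper : ∀ z w, w ∈ L.lattice → g (z + w) = g z := by
    intro z w hw
    have h1 : L.weierstrassP (z + w) = L.weierstrassP z := L.weierstrassP_add_coe z ⟨w, hw⟩
    simp only [hg, L.lattice.add_mem_iff_left hw, h1]
  have hconst := hdiff.apply_eq_apply_of_bounded
    (IsZLattice.isCompact_range_of_periodic L.lattice g hdiff.continuous hper).isBounded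
  obtain ⟨z, hz⟩ := (L.eventually_notMem_lattice 0).exists
  have := hconst z 0
  simp [hg, hz, sub_eq_zero, hne z hz] at this

end PeriodPair

/-! ### The addition formulas. -/

namespace PeriodPair

open Filter Set

variable (L : PeriodPair)

lemma weierstrassP_eq_weierstrassPExcept (l : L.lattice) (z : ℂ) :
    L.weierstrassP z = L.weierstrassPExcept l z + (1 / (z - l) ^ 2 - 1 / (l : ℂ) ^ 2) :=
  (L.weierstrassPExcept_add l z).symm

lemma derivWeierstrassP_eq_derivWeierstrassPExcept (l : L.lattice) (z : ℂ) :
    L.derivWeierstrassP z = L.derivWeierstrassPExcept l z - 2 / (z - l) ^ 3 :=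
  (L.derivWeierstrassPExcept_sub l z).symm

/-- The `x`-coordinate of the sum of the points with parameters `t` and `c - t`. -/
noncomputable def chordX (c t : ℂ) : ℂ :=
  ((L.derivWeierstrassP t - L.derivWeierstrassP (c - t)) /
    (L.weierstrassP t - L.weierstrassP (c - t))) ^ 2 / 4 - L.weierstrassP t - L.weierstrassP (c - t)

lemma eventually_const_sub_notMem_lattice {c t : ℂ} (h : c - t ∉ L.lattice) :
    ∀ᶠ s in 𝓝 t, c - s ∉ L.lattice := by
  have hc : ContinuousAt (fun s : ℂ ↦ c - s) t := by fun_prop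
  exact hc.eventually (L.isOpen_compl_lattice.mem_nhds h)

/-- With λ the quotient of the differences of ℘' and ℘, the differential equations give λ' = 2(℘(t)
- ℘(c - t)). So λ²/4 has derivative ℘'(t) - ℘'(c - t), which is also the derivative of ℘(t) + ℘(c -
t). -/
lemma deriv_chordX {c t : ℂ} (ht : t ∉ L.lattice) (hct : c - t ∉ L.lattice)
    (hne : L.weierstrassP t ≠ L.weierstrassP (c - t)) : deriv (L.chordX c) t = 0 := by
  have h1 := L.hasDerivAt_weierstrassP ht
  have h2 := L.hasDerivAt_derivWeierstrassP ht
  have h3 := (L.hasDerivAt_weierstrassP hct).comp_const_sub c t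
  have h4 := (L.hasDerivAt_derivWeierstrassP hct).comp_const_sub c t
  have hne' := sub_ne_zero.mpr hne
  have h5 := ((((h2.sub h4).div (h1.sub h3) hne').fun_pow 2).div_const 4 |>.sub h1).sub h3
  have h6 : HasDerivAt (L.chordX c) _ t := h5
  rw [h6.deriv]
  have e1 := L.derivWeierstrassP_sq t ht
  have e2 := L.derivWeierstrassP_sq (c - t) hct
  simp only [Pi.sub_apply, Pi.div_apply]
  generalize L.weierstrassP t = X at *
  generalize L.weierstrassP (c - t) = x at *
  generalize L.derivWeierstrassP t = Y at *
  generalize L.derivWeierstrassP (c - t) = y at *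
  have hlam : ((6 * X ^ 2 - L.g₂ / 2 - -(6 * x ^ 2 - L.g₂ / 2)) * (X - x)
      - (Y - y) * (Y - -y)) / (X - x) ^ 2 = 2 * (X - x) := by
    field_simp
    linear_combination 2 * e2 - 2 * e1
  rw [hlam]
  have hr : (Y - y) / (X - x) * (X - x) = Y - y := div_mul_cancel₀ _ hne'
  simp only [Nat.cast_ofNat, Nat.add_one_sub_one, pow_one]
  linear_combination hr

/-- The analytic continuation to `t = 0` of `chordX c`. -/
noncomputable def chordXAux (c t : ℂ) : ℂ :=
  (t ^ 4 * (L.derivWeierstrassPExcept 0 t - L.derivWeierstrassP (c - t)) ^ 2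
    - 4 * t * (L.derivWeierstrassPExcept 0 t - L.derivWeierstrassP (c - t))
    - 8 * (L.weierstrassPExcept 0 t - L.weierstrassP (c - t))
    - 4 * t ^ 2 * (L.weierstrassPExcept 0 t - L.weierstrassP (c - t)) ^ 2) /
    (4 * (1 + t ^ 2 * (L.weierstrassPExcept 0 t - L.weierstrassP (c - t))) ^ 2)
    - L.weierstrassPExcept 0 t - L.weierstrassP (c - t)

lemma chordXAux_zero (c : ℂ) : L.chordXAux c 0 = L.weierstrassP c := by
  simp [chordXAux]; ring

variable {c : ℂ}

lemma analyticAt_weierstrassP_const_sub {t : ℂ} (h : c - t ∉ L.lattice) :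
    AnalyticAt ℂ (fun s ↦ L.weierstrassP (c - s)) t :=
  (L.analyticAt_weierstrassP h).fun_comp_of_eq (f := fun s : ℂ ↦ c - s) (by fun_prop) rfl

lemma analyticAt_derivWeierstrassP_const_sub {t : ℂ} (h : c - t ∉ L.lattice) :
    AnalyticAt ℂ (fun s ↦ L.derivWeierstrassP (c - s)) t :=
  (L.analyticAt_derivWeierstrassP h).fun_comp_of_eq (f := fun s : ℂ ↦ c - s) (by fun_prop) rfl

lemma analyticAt_chordXAux (hc : c ∉ L.lattice) : AnalyticAt ℂ (L.chordXAux c) 0 := by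
  have h0 : c - 0 ∉ L.lattice := by simpa using hc
  have h1 := L.analyticAt_weierstrassP_const_sub h0
  have h2 := L.analyticAt_derivWeierstrassP_const_sub h0
  have h3 := L.analyticAt_weierstrassPExcept 0
  have h4 := L.analyticAt_derivWeierstrassPExcept 0
  unfold chordXAux
  have hden : (4 * (1 + (0 : ℂ) ^ 2 * (L.weierstrassPExcept 0 0 - L.weierstrassP (c - 0))) ^ 2)
      ≠ 0 := by simp
  fun_prop (disch := exact hden)

lemma eventually_chordX (hc : c ∉ L.lattice) : ∀ᶠ t in 𝓝[≠] 0, t ∉ L.lattice ∧ c - t ∉ L.lattice ∧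
    L.weierstrassP t ≠ L.weierstrassP (c - t) ∧ L.chordX c t = L.chordXAux c t := by
  have h0 : c - 0 ∉ L.lattice := by simpa using hc
  have h1 := L.analyticAt_weierstrassP_const_sub h0
  have h3 := L.analyticAt_weierstrassPExcept 0
  have hden : ∀ᶠ t in 𝓝 0, 1 + t ^ 2 * (L.weierstrassPExcept 0 t - L.weierstrassP (c - t)) ≠ 0 := by
    have : AnalyticAt ℂ (fun t ↦ 1 + t ^ 2 * (L.weierstrassPExcept 0 t - L.weierstrassP (c - t)))
      0 := by fun_prop
    exact this.continuousAt.eventually_ne (by simp)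
  filter_upwards [L.eventually_notMem_lattice 0, self_mem_nhdsWithin, nhdsWithin_le_nhds hden,
    nhdsWithin_le_nhds (L.eventually_const_sub_notMem_lattice h0)] with t ht ht0 hd hct
  have e1 : L.weierstrassP t = L.weierstrassPExcept 0 t + 1 / t ^ 2 := by
    simpa using L.weierstrassP_eq_weierstrassPExcept 0 t
  have e2 : L.derivWeierstrassP t = L.derivWeierstrassPExcept 0 t - 2 / t ^ 3 := by
    simpa using L.derivWeierstrassP_eq_derivWeierstrassPExcept 0 t
  have ht0' : t ≠ 0 := ht0
  refine ⟨ht, hct, ?_, ?_⟩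
  · rw [e1]
    intro h
    apply hd
    rw [← h]
    field_simp
    ring
  · unfold chordX chordXAux
    rw [e1, e2]
    generalize L.weierstrassPExcept 0 t = e at *
    generalize L.derivWeierstrassPExcept 0 t = b at *
    generalize L.weierstrassP (c - t) = x at *
    generalize L.derivWeierstrassP (c - t) = y at *
    -- Clearing the poles of ℘ and ℘' leaves a single factor t in the denominator, so λ²/4 has the
    -- double pole 1/t², which the 1/t² in ℘(t) cancels.
    have hr : (b - 2 / t ^ 3 - y) / (e + 1 / t ^ 2 - x)
        = (t ^ 3 * (b - y) - 2) / (t * (1 + t ^ 2 * (e - x))) := by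
      have : e + 1 / t ^ 2 - x = (1 + t ^ 2 * (e - x)) / t ^ 2 := by field_simp; ring
      rw [this]
      field_simp
      ring
    rw [hr]
    generalize hD : 1 + t ^ 2 * (e - x) = D at *
    have hx : e = x + (D - 1) / t ^ 2 := by rw [← hD]; field_simp; ring
    rw [hx]
    field_simp
    ring

/-- Along the line `z + w = c` the chord construction gives the point with parameter `c`. -/
lemma eventually_chordX_eq (hc : c ∉ L.lattice) :
    ∀ᶠ t in 𝓝[≠] 0, L.chordX c t = L.weierstrassP c := by
  have ev := L.eventually_chordX hc
  have hA := L.analyticAt_chordXAux hc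
  have h1 : ∀ᶠ t in 𝓝[≠] 0, deriv (L.chordXAux c) t = 0 := by
    have ev' := eventually_eventually_nhdsWithin.mpr ev
    filter_upwards [ev', ev, self_mem_nhdsWithin] with t ht ht' ht0
    rw [isOpen_compl_singleton.nhdsWithin_eq ht0] at ht
    have : L.chordXAux c =ᶠ[𝓝 t] L.chordX c := by
      filter_upwards [ht] with s hs using hs.2.2.2.symm
    rw [this.deriv_eq, L.deriv_chordX ht'.1 ht'.2.1 ht'.2.2.1]
  -- The zeros of the analytic derivative accumulate at 0, so `chordXAux c` is constant near 0, with
  -- value ℘(c).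
  have h2 : ∀ᶠ t in 𝓝 0, deriv (L.chordXAux c) t = 0 :=
    hA.deriv.frequently_zero_iff_eventually_zero.mp h1.frequently
  have h3 := hA.analyticOrderAt_deriv_add_one
  rw [analyticOrderAt_eq_top.mpr h2] at h3
  have h4 := analyticOrderAt_eq_top.mp h3.symm
  filter_upwards [ev, nhdsWithin_le_nhds h4] with t ht ht4
  rw [ht.2.2.2, ← L.chordXAux_zero c]
  exact sub_eq_zero.mp ht4

/-- The addition formula for `℘`, without denominators. -/
theorem weierstrassP_add {z w : ℂ} (hz : z ∉ L.lattice) (hw : w ∉ L.lattice)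
    (hzw : z + w ∉ L.lattice) :
    (L.derivWeierstrassP z - L.derivWeierstrassP w) ^ 2 =
      4 * (L.weierstrassP (z + w) + L.weierstrassP z + L.weierstrassP w) *
        (L.weierstrassP z - L.weierstrassP w) ^ 2 := by
  obtain ⟨c, rfl⟩ : ∃ c, w = c - z := ⟨z + w, by ring⟩
  rw [add_sub_cancel] at hzw ⊢
  -- The defect of the formula along z + w = c. Without denominators it is analytic on all of V,
  -- including where ℘(t) = ℘(c - t), so its vanishing near 0 spreads over V.
  set P : ℂ → ℂ := fun t ↦ (L.derivWeierstrassP t - L.derivWeierstrassP (c - t)) ^ 2 -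
    4 * (L.weierstrassP c + L.weierstrassP t + L.weierstrassP (c - t)) *
        (L.weierstrassP t - L.weierstrassP (c - t)) ^ 2 with hP
  set V : Set ℂ := ((L.lattice : Set ℂ) ∪ (fun z ↦ c - z) ⁻¹' (L.lattice : Set ℂ))ᶜ with hV
  have memV {t : ℂ} : t ∈ V ↔ t ∉ L.lattice ∧ c - t ∉ L.lattice := by simp [hV]
  have cV : IsPreconnected V := by
    refine (Set.Countable.isConnected_compl_of_one_lt_rank
      (Complex.rank_real_complex ▸ Nat.one_lt_ofNat) ?_).isPreconnected
    exact L.countable_lattice.union (L.countable_lattice.preimage sub_right_injective)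
  have hPV : AnalyticOnNhd ℂ P V := by
    intro t ht
    rw [memV] at ht
    have h1 := L.analyticAt_weierstrassP ht.1
    have h2 := L.analyticAt_derivWeierstrassP ht.1
    have h3 := L.analyticAt_weierstrassP_const_sub ht.2
    have h4 := L.analyticAt_derivWeierstrassP_const_sub ht.2
    fun_prop
  have ev : ∀ᶠ t in 𝓝[≠] 0, t ∈ V ∧ P t = 0 := by
    filter_upwards [L.eventually_chordX hzw, L.eventually_chordX_eq hzw] with t ht ht'
    refine ⟨memV.mpr ⟨ht.1, ht.2.1⟩, ?_⟩
    have hne := sub_ne_zero.mpr ht.2.2.1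
    unfold chordX at ht'
    simp only [hP]
    rw [← ht']
    field_simp
    ring
  obtain ⟨t, ⟨ht, htV, -⟩, ht0⟩ := ((eventually_eventually_nhdsWithin.mpr ev).and
    ev |>.and self_mem_nhdsWithin).exists
  rw [isOpen_compl_singleton.nhdsWithin_eq ht0] at ht
  have := hPV.eqOn_zero_of_preconnected_of_eventuallyEq_zero cV htV (ht.mono fun s hs ↦ hs.2)
    (memV.mpr ⟨hz, hw⟩)
  exact sub_eq_zero.mp this

/-- The addition formula for `℘'`. -/
theorem derivWeierstrassP_add {z w : ℂ} (hz : z ∉ L.lattice) (hw : w ∉ L.lattice)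
    (hzw : z + w ∉ L.lattice) (hne : L.weierstrassP z ≠ L.weierstrassP w) :
    L.derivWeierstrassP (z + w) = -(L.derivWeierstrassP z +
      (L.derivWeierstrassP z - L.derivWeierstrassP w) / (L.weierstrassP z - L.weierstrassP w) *
        (L.weierstrassP (z + w) - L.weierstrassP z)) := by
  have h1 := L.hasDerivAt_weierstrassP hz
  have h2 := L.hasDerivAt_derivWeierstrassP hz
  have h3 := (L.hasDerivAt_weierstrassP hzw).comp_add_const z w
  have hne' := sub_ne_zero.mpr hne
  have h4 := (((h2.sub_const (L.derivWeierstrassP w)).fun_div (h1.sub_const (L.weierstrassP w))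
    hne').fun_pow 2).div_const 4 |>.fun_sub h1 |>.sub_const (L.weierstrassP w)
  have key : ∀ v, v ∉ L.lattice → v + w ∉ L.lattice → L.weierstrassP v ≠ L.weierstrassP w →
      L.weierstrassP (v + w) = ((L.derivWeierstrassP v - L.derivWeierstrassP w) /
        (L.weierstrassP v - L.weierstrassP w)) ^ 2 / 4 - L.weierstrassP v - L.weierstrassP w := by
    intro v hv hvw hvne
    have := sub_ne_zero.mpr hvne
    have h := L.weierstrassP_add hv hw hvw
    field_simp
    linear_combination -h
  have hc : ContinuousAt (fun v : ℂ ↦ v + w) z := by fun_prop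
  -- The formula for ℘' is the z-derivative of the one for ℘, with w fixed.
  have h5 := h3.congr_of_eventuallyEq (f₁ := fun v ↦ ((L.derivWeierstrassP v -
      L.derivWeierstrassP w) / (L.weierstrassP v - L.weierstrassP w)) ^ 2 / 4
      - L.weierstrassP v - L.weierstrassP w) (by
    filter_upwards [L.isOpen_compl_lattice.mem_nhds hz,
      hc.eventually (L.isOpen_compl_lattice.mem_nhds hzw),
      h1.continuousAt.eventually_ne hne] with v hv hvw hvne
    exact (key v hv hvw hvne).symm)
  rw [h5.unique h4]
  have e1 := L.derivWeierstrassP_sq z hz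
  have e2 := L.derivWeierstrassP_sq w hw
  rw [key z hz hzw hne]
  generalize L.weierstrassP z = X at *
  generalize L.weierstrassP w = x at *
  generalize L.derivWeierstrassP z = Y at *
  generalize L.derivWeierstrassP w = y at *
  have hlam : ((6 * X ^ 2 - L.g₂ / 2) * (X - x) - (Y - y) * Y) / (X - x) ^ 2 =
      2 * (2 * X + x - ((Y - y) / (X - x)) ^ 2 / 4) := by
    field_simp
    linear_combination 4 * e2 - 4 * e1
  rw [hlam]
  ring

end PeriodPair

/-! ### Gauss's integral for the arithmetic-geometric mean. -/

section AgmIntegral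

open MeasureTheory Set Filter

/-- Gauss's form of the complete elliptic integral of the first kind. -/
noncomputable def agmIntegral (a b : ℝ) : ℝ :=
  ∫ t in Ioi (0 : ℝ), (√((a ^ 2 + t ^ 2) * (b ^ 2 + t ^ 2)))⁻¹

lemma inv_sq_add_sq_eq {b : ℝ} (hb : 0 < b) (t : ℝ) :
    (b ^ 2 + t ^ 2)⁻¹ = (b ^ 2)⁻¹ * (1 + (b⁻¹ * t) ^ 2)⁻¹ := by
  field_simp

lemma integrable_inv_sq_add_sq {b : ℝ} (hb : 0 < b) :
    Integrable fun t : ℝ ↦ (b ^ 2 + t ^ 2)⁻¹ := by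
  simp_rw [inv_sq_add_sq_eq hb]
  exact (integrable_inv_one_add_sq.comp_mul_left' (inv_ne_zero hb.ne')).const_mul _

lemma integral_Ioi_inv_sq_add_sq {b : ℝ} (hb : 0 < b) :
    ∫ t in Ioi (0 : ℝ), (b ^ 2 + t ^ 2)⁻¹ = Real.pi / (2 * b) := by
  simp_rw [inv_sq_add_sq_eq hb]
  rw [integral_const_mul, integral_comp_mul_left_Ioi (fun x : ℝ ↦ (1 + x ^ 2)⁻¹) 0 (inv_pos.mpr hb)]
  simp
  field_simp

lemma sqrt_mul_add_sq_bounds {a b : ℝ} (hb : 0 < b) (hba : b ≤ a) (t : ℝ) :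
    (a ^ 2 + t ^ 2)⁻¹ ≤ (√((a ^ 2 + t ^ 2) * (b ^ 2 + t ^ 2)))⁻¹ ∧
      (√((a ^ 2 + t ^ 2) * (b ^ 2 + t ^ 2)))⁻¹ ≤ (b ^ 2 + t ^ 2)⁻¹ := by
  have h0 : 0 < b ^ 2 + t ^ 2 := by positivity
  have h1 : b ^ 2 + t ^ 2 ≤ a ^ 2 + t ^ 2 := by gcongr
  have h2 : 0 < a ^ 2 + t ^ 2 := h0.trans_le h1
  constructor
  · refine inv_anti₀ (by positivity) (Real.sqrt_le_iff.mpr ⟨h2.le, ?_⟩)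
    rw [sq (a ^ 2 + t ^ 2)]
    gcongr
  · refine inv_anti₀ h0 (Real.le_sqrt_of_sq_le ?_)
    rw [sq (b ^ 2 + t ^ 2)]
    gcongr

/-- Replacing both parameters by the larger or by the smaller one leaves an arctangent integral.
These bounds pinch the integral once a and b have a common limit. -/
lemma agmIntegral_bounds {a b : ℝ} (hb : 0 < b) (hba : b ≤ a) :
    Real.pi / (2 * a) ≤ agmIntegral a b ∧ agmIntegral a b ≤ Real.pi / (2 * b) := by
  have ha := hb.trans_le hba
  have hi : Integrable fun t : ℝ ↦ (√((a ^ 2 + t ^ 2) * (b ^ 2 + t ^ 2)))⁻¹ := by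
    refine (integrable_inv_sq_add_sq hb).mono' (by fun_prop) (ae_of_all _ fun t ↦ ?_)
    rw [Real.norm_of_nonneg (by positivity)]
    exact (sqrt_mul_add_sq_bounds hb hba t).2
  rw [← integral_Ioi_inv_sq_add_sq ha, ← integral_Ioi_inv_sq_add_sq hb]
  exact ⟨integral_mono (integrable_inv_sq_add_sq ha).integrableOn hi.integrableOn
      fun t ↦ (sqrt_mul_add_sq_bounds hb hba t).1,
    integral_mono hi.integrableOn (integrable_inv_sq_add_sq hb).integrableOn
      fun t ↦ (sqrt_mul_add_sq_bounds hb hba t).2⟩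

lemma agmIntegral_comm (a b : ℝ) : agmIntegral a b = agmIntegral b a := by
  simp only [agmIntegral, mul_comm]

/-- Gauss's substitution `u = (t - a b / t) / 2`. -/
lemma agmIntegral_mean {a b : ℝ} (ha : 0 < a) (hb : 0 < b) :
    agmIntegral (√(a * b)) ((a + b) / 2) = agmIntegral a b := by
  have hab : 0 < a * b := mul_pos ha hb
  set g : ℝ → ℝ := fun u ↦ (√((√(a * b) ^ 2 + u ^ 2) * (((a + b) / 2) ^ 2 + u ^ 2)))⁻¹ with hg
  set f : ℝ → ℝ := fun t ↦ (t - a * b / t) / 2 with hf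
  have hderiv : ∀ t ∈ Ioi (0 : ℝ),
      HasDerivWithinAt f ((1 + a * b / t ^ 2) / 2) (Ioi 0) t := by
    intro t ht
    have ht0 : t ≠ 0 := (mem_Ioi.mp ht).ne'
    have h : HasDerivWithinAt f _ _ _ :=
      (((hasDerivAt_id t).sub ((hasDerivAt_inv ht0).const_mul (a * b))).div_const
      2).hasDerivWithinAt (s := Ioi 0)
    refine h.congr_deriv ?_
    field_simp
    ring
  have hmono : StrictMonoOn f (Ioi 0) := by
    intro s hs t ht hst
    have hs' : 0 < s := hs
    have : a * b / t < a * b / s := by gcongr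
    simp only [hf]
    linarith
  have himage : f '' Ioi 0 = univ := by
    refine eq_univ_of_forall fun u ↦ ?_
    have hsq : √(u ^ 2 + a * b) ^ 2 = u ^ 2 + a * b := Real.sq_sqrt (by positivity)
    have hlt : |u| < √(u ^ 2 + a * b) := by
      rw [← Real.sqrt_sq_eq_abs]
      exact Real.sqrt_lt_sqrt (sq_nonneg u) (by linarith)
    have hpos : 0 < u + √(u ^ 2 + a * b) := by linarith [neg_abs_le u]
    -- The positive root of t² - 2ut - ab = 0.
    refine ⟨u + √(u ^ 2 + a * b), hpos, ?_⟩
    simp only [hf]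
    field_simp
    linear_combination hsq
  have h1 := integral_image_eq_integral_abs_deriv_smul measurableSet_Ioi hderiv hmono.injOn g
  rw [himage, setIntegral_univ] at h1
  have h2 : ∫ u, g u = 2 * agmIntegral (√(a * b)) ((a + b) / 2) := by
    rw [agmIntegral, ← integral_comp_abs]
    simp [hg]
  have h3 : ∫ t in Ioi (0 : ℝ), |(1 + a * b / t ^ 2) / 2| • g (f t) = 2 * agmIntegral a b := by
    rw [agmIntegral, ← integral_const_mul]
    refine setIntegral_congr_fun measurableSet_Ioi fun t ht ↦ ?_
    have ht0 : 0 < t := ht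
    -- Here ab + f² = (t + ab/t)²/4 and ((a + b)/2)² + f² = (a² + t²)(b² + t²)/(4t²). The square
    -- root of the product absorbs f' = (1 + ab/t²)/2 up to a factor 2, which matches the integral
    -- over all of ℝ.
    have hprod : (√(a * b) ^ 2 + f t ^ 2) * (((a + b) / 2) ^ 2 + f t ^ 2) =
        ((1 + a * b / t ^ 2) / 4) ^ 2 * ((a ^ 2 + t ^ 2) * (b ^ 2 + t ^ 2)) := by
      rw [Real.sq_sqrt hab.le]
      simp only [hf]
      field_simp
      ring
    simp only [hg, smul_eq_mul]
    rw [hprod, Real.sqrt_mul (by positivity), Real.sqrt_sq (by positivity),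
      abs_of_pos (by positivity)]
    field_simp
    norm_num
  linarith

lemma agmIntegral_agmSequences {a b : NNReal} (ha : 0 < a) (hb : 0 < b) (n : ℕ) :
    agmIntegral (NNReal.agmSequences a b n).1 (NNReal.agmSequences a b n).2 = agmIntegral a b := by
  induction n generalizing a b with
  -- The sequences start at the first pair of means, not at (a, b), so the base case already needs
  -- one step of invariance.
  | zero => simpa using agmIntegral_mean (a := a) (b := b) ha hb
  | succ n ih =>
    rw [NNReal.agmSequences_succ, ih (by positivity) (by positivity)]
    simpa using agmIntegral_mean (a := a) (b := b) ha hb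

/-- Gauss's formula for the arithmetic-geometric mean. -/
theorem agmIntegral_eq {a b : NNReal} (ha : 0 < a) (hb : 0 < b) :
    agmIntegral a b = Real.pi / (2 * NNReal.agm a b) := by
  have hpos : (0 : ℝ) < NNReal.agm a b := NNReal.agm_pos ha hb
  have h1 : Tendsto (fun n ↦ ((NNReal.agmSequences a b n).1 : ℝ)) atTop (𝓝 (NNReal.agm a b)) :=
    (NNReal.continuous_coe.tendsto _).comp NNReal.tendsto_agmSequences_fst_agm
  have h2 : Tendsto (fun n ↦ ((NNReal.agmSequences a b n).2 : ℝ)) atTop (𝓝 (NNReal.agm a b)) :=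
    (NNReal.continuous_coe.tendsto _).comp NNReal.tendsto_agmSequences_snd_agm
  have h3 (n : ℕ) := agmIntegral_bounds (a := (NNReal.agmSequences a b n).2)
    (b := (NNReal.agmSequences a b n).1)
    (by
      have : 0 < (NNReal.agmSequences a b 0).1 := NNReal.sqrt_pos.2 (mul_pos ha hb)
      exact_mod_cast this.trans_le (NNReal.agmSequences_fst_monotone n.zero_le))
    (by exact_mod_cast NNReal.agmSequences_fst_le_snd n n)
  -- The integral is constant along the iteration, whereas both bounds tend to π / (2 M(a, b)).
  simp_rw [agmIntegral_comm (NNReal.agmSequences a b _).2, agmIntegral_agmSequences ha hb] at h3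
  have hne : (2 * NNReal.agm a b : ℝ) ≠ 0 := by positivity
  apply le_antisymm
  · exact ge_of_tendsto' (tendsto_const_nhds.div (h1.const_mul 2) hne) fun n ↦ (h3 n).2
  · exact le_of_tendsto' (tendsto_const_nhds.div (h2.const_mul 2) hne) fun n ↦ (h3 n).1

end AgmIntegral

/-! ### Square lattices: real values of `℘`, and the invariants `g₂`, `g₃`. -/

namespace PeriodPair

open Filter Set

variable {L : PeriodPair}

/-- The points p and -p agree modulo Λ, and ℘' is odd. -/
lemma derivWeierstrassP_eq_zero_of_add_self_mem {p : ℂ} (h : p + p ∈ L.lattice) :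
    L.derivWeierstrassP p = 0 := by
  have h1 : L.derivWeierstrassP (-p + (p + p)) = L.derivWeierstrassP (-p) :=
    L.derivWeierstrassP_add_coe (-p) ⟨p + p, h⟩
  rw [neg_add_cancel_left, derivWeierstrassP_neg] at h1
  exact self_eq_neg.mp h1

/-- The periods of `L` are `c` and `i c` for some `c > 0`. -/
structure IsSquareWithSide (L : PeriodPair) (c : ℝ) : Prop where
  pos : 0 < c
  omega₁_eq : L.ω₁ = c
  omega₂_eq : L.ω₂ = Complex.I * c

namespace IsSquareWithSide

variable {c : ℝ} (hL : L.IsSquareWithSide c)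
include hL

lemma mem_lattice_iff {z : ℂ} :
    z ∈ L.lattice ↔ ∃ m n : ℤ, z.re = m * c ∧ z.im = n * c := by
  rw [PeriodPair.mem_lattice, hL.omega₁_eq, hL.omega₂_eq]
  refine exists₂_congr fun m n ↦ ?_
  rw [Complex.ext_iff]
  simp [eq_comm]

lemma I_mul_mem_lattice {z : ℂ} (hz : z ∈ L.lattice) : Complex.I * z ∈ L.lattice := by
  obtain ⟨m, n, h1, h2⟩ := hL.mem_lattice_iff.mp hz
  exact hL.mem_lattice_iff.mpr ⟨-n, m, by simp [h2], by simp [h1]⟩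

lemma conj_mem_lattice {z : ℂ} (hz : z ∈ L.lattice) : (starRingEnd ℂ) z ∈ L.lattice := by
  obtain ⟨m, n, h1, h2⟩ := hL.mem_lattice_iff.mp hz
  exact hL.mem_lattice_iff.mpr ⟨m, -n, by simp [h1], by simp [h2]⟩

/-- Multiplication by i permutes Λ, and the terms of the series are homogeneous of degree -2. -/
lemma weierstrassP_I_mul (z : ℂ) : L.weierstrassP (Complex.I * z) = -L.weierstrassP z := by
  let e : L.lattice ≃ L.lattice :=
    { toFun := fun l ↦ ⟨Complex.I * l, hL.I_mul_mem_lattice l.2⟩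
      invFun := fun l ↦ ⟨-(Complex.I * l), neg_mem (hL.I_mul_mem_lattice l.2)⟩
      left_inv := fun l ↦ by ext; simp [← mul_assoc]
      right_inv := fun l ↦ by ext; simp [← mul_assoc] }
  unfold weierstrassP
  rw [← e.tsum_eq, ← tsum_neg]
  refine tsum_congr fun l ↦ ?_
  simp only [e, Equiv.coe_fn_mk, ← mul_sub, mul_pow, Complex.I_sq, neg_one_mul, div_neg]
  ring

lemma weierstrassP_conj (z : ℂ) :
    L.weierstrassP ((starRingEnd ℂ) z) = (starRingEnd ℂ) (L.weierstrassP z) := by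
  let e : L.lattice ≃ L.lattice :=
    { toFun := fun l ↦ ⟨(starRingEnd ℂ) l, hL.conj_mem_lattice l.2⟩
      invFun := fun l ↦ ⟨(starRingEnd ℂ) l, hL.conj_mem_lattice l.2⟩
      left_inv := fun l ↦ by ext; simp
      right_inv := fun l ↦ by ext; simp }
  unfold weierstrassP
  rw [Complex.conj_tsum, ← e.tsum_eq]
  exact tsum_congr fun l ↦ by simp [e]

lemma derivWeierstrassP_conj (z : ℂ) :
    L.derivWeierstrassP ((starRingEnd ℂ) z) = (starRingEnd ℂ) (L.derivWeierstrassP z) := by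
  let e : L.lattice ≃ L.lattice :=
    { toFun := fun l ↦ ⟨(starRingEnd ℂ) l, hL.conj_mem_lattice l.2⟩
      invFun := fun l ↦ ⟨(starRingEnd ℂ) l, hL.conj_mem_lattice l.2⟩
      left_inv := fun l ↦ by ext; simp
      right_inv := fun l ↦ by ext; simp }
  unfold derivWeierstrassP
  rw [map_neg, Complex.conj_tsum, ← e.tsum_eq]
  exact congrArg Neg.neg (tsum_congr fun l ↦ by simp [e, map_ofNat])

lemma ofReal_re_weierstrassP (s : ℝ) : ((L.weierstrassP s).re : ℂ) = L.weierstrassP s :=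
  Complex.conj_eq_iff_re.mp (by rw [← hL.weierstrassP_conj, Complex.conj_ofReal])

lemma ofReal_re_derivWeierstrassP (s : ℝ) :
    ((L.derivWeierstrassP s).re : ℂ) = L.derivWeierstrassP s :=
  Complex.conj_eq_iff_re.mp (by rw [← hL.derivWeierstrassP_conj, Complex.conj_ofReal])

lemma int_ne_of_lt {x : ℝ} (h0 : 0 < x) (h1 : x < c) (m : ℤ) : x ≠ m * c := by
  rintro rfl
  have hm : (0 : ℝ) < m := pos_of_mul_pos_left h0 hL.pos.le
  have hm' : (m : ℝ) < 1 := by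
    by_contra! h
    nlinarith [hL.pos]
  norm_cast at hm hm'
  omega

lemma notMem_lattice_of_re {z : ℂ} (h0 : 0 < z.re) (h1 : z.re < c) : z ∉ L.lattice := by
  intro h
  obtain ⟨m, -, hm, -⟩ := hL.mem_lattice_iff.mp h
  exact hL.int_ne_of_lt h0 h1 m hm

lemma notMem_lattice_of_im {z : ℂ} (h0 : 0 < z.im) (h1 : z.im < c) : z ∉ L.lattice := by
  intro h
  obtain ⟨-, n, -, hn⟩ := hL.mem_lattice_iff.mp h
  exact hL.int_ne_of_lt h0 h1 n hn

lemma half_notMem : ((c / 2 : ℝ) : ℂ) ∉ L.lattice :=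
  hL.notMem_lattice_of_re (by simpa using hL.pos) (by simpa using hL.pos)

lemma I_mul_half_notMem : Complex.I * ((c / 2 : ℝ) : ℂ) ∉ L.lattice :=
  hL.notMem_lattice_of_im (by simpa using hL.pos) (by simpa using hL.pos)

lemma diag_notMem : (1 + Complex.I) * ((c / 2 : ℝ) : ℂ) ∉ L.lattice :=
  hL.notMem_lattice_of_im (by simpa using hL.pos) (by simpa using hL.pos)

lemma derivWeierstrassP_half : L.derivWeierstrassP (c / 2 : ℝ) = 0 :=
  derivWeierstrassP_eq_zero_of_add_self_mem
    (hL.mem_lattice_iff.mpr ⟨1, 0, by simp, by simp⟩)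

lemma derivWeierstrassP_I_mul_half : L.derivWeierstrassP (Complex.I * (c / 2 : ℝ)) = 0 :=
  derivWeierstrassP_eq_zero_of_add_self_mem
    (hL.mem_lattice_iff.mpr ⟨0, 1, by simp, by simp⟩)

lemma derivWeierstrassP_diag : L.derivWeierstrassP ((1 + Complex.I) * (c / 2 : ℝ)) = 0 :=
  derivWeierstrassP_eq_zero_of_add_self_mem
    (hL.mem_lattice_iff.mpr ⟨1, 1, by simp, by simp⟩)

/-- Modulo Λ this half-period is fixed by multiplication by i, which changes the sign of ℘. -/
lemma weierstrassP_diag : L.weierstrassP ((1 + Complex.I) * (c / 2 : ℝ)) = 0 := by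
  have h1 := hL.weierstrassP_I_mul ((1 + Complex.I) * (c / 2 : ℝ))
  have h2 := L.weierstrassP_sub_coe ((1 + Complex.I) * (c / 2 : ℝ)) ⟨c,
    hL.mem_lattice_iff.mpr ⟨1, 0, by simp, by simp⟩⟩
  have h3 : (1 + Complex.I) * ((c / 2 : ℝ) : ℂ) - c = Complex.I * ((1 + Complex.I) * (c / 2 : ℝ)) := by
    push_cast
    linear_combination (-(c : ℂ) / 2) * Complex.I_sq
  simp only [h3] at h2
  rw [h2] at h1
  exact self_eq_neg.mp h1

lemma g₃_eq_zero : L.g₃ = 0 := by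
  have h := L.derivWeierstrassP_sq _ hL.diag_notMem
  rw [hL.derivWeierstrassP_diag, hL.weierstrassP_diag] at h
  linear_combination h

/-- Otherwise ℘ and ℘' would both vanish at c/2 and at ic/2, which are not congruent modulo Λ. -/
lemma weierstrassP_half_ne_zero : L.weierstrassP (c / 2 : ℝ) ≠ 0 := by
  intro h
  have h1 := L.sub_mem_lattice_of_eq hL.I_mul_half_notMem hL.half_notMem
    (by rw [hL.weierstrassP_I_mul, h, neg_zero])
    (by rw [hL.derivWeierstrassP_half, hL.derivWeierstrassP_I_mul_half])
  exact hL.notMem_lattice_of_im (by simpa using hL.pos) (by simpa using hL.pos) h1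

lemma g₂_eq : L.g₂ = 4 * L.weierstrassP (c / 2 : ℝ) ^ 2 := by
  have h := L.derivWeierstrassP_sq _ hL.half_notMem
  rw [hL.derivWeierstrassP_half, hL.g₃_eq_zero] at h
  refine mul_right_cancel₀ hL.weierstrassP_half_ne_zero ?_
  linear_combination h

lemma ofReal_notMem {s : ℝ} (hs : s ∈ Ioc 0 (c / 2)) : (s : ℂ) ∉ L.lattice :=
  hL.notMem_lattice_of_re (by simpa using hs.1) (by
    have := hL.pos
    simpa using hs.2.trans_lt (by linarith))

lemma hasDerivAt_re {s : ℝ} (hs : s ∈ Ioc 0 (c / 2)) :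
    HasDerivAt (fun x : ℝ ↦ (L.weierstrassP x).re) (L.derivWeierstrassP s).re s :=
  (L.hasDerivAt_weierstrassP (hL.ofReal_notMem hs)).real_of_complex

lemma re_derivWeierstrassP_sq {s : ℝ} (hs : s ∈ Ioc 0 (c / 2)) :
    (L.derivWeierstrassP s).re ^ 2 = 4 * (L.weierstrassP s).re *
      (((L.weierstrassP s).re - (L.weierstrassP (c / 2 : ℝ)).re) *
        ((L.weierstrassP s).re + (L.weierstrassP (c / 2 : ℝ)).re)) := by
  have h := L.derivWeierstrassP_sq s (hL.ofReal_notMem hs)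
  rw [hL.g₂_eq, hL.g₃_eq_zero, ← hL.ofReal_re_weierstrassP, ← hL.ofReal_re_derivWeierstrassP,
    ← hL.ofReal_re_weierstrassP (c / 2)] at h
  have h' : (L.derivWeierstrassP s).re ^ 2 = 4 * (L.weierstrassP s).re ^ 3 -
      4 * (L.weierstrassP (c / 2 : ℝ)).re ^ 2 * (L.weierstrassP s).re - 0 := by exact_mod_cast h
  linear_combination h'

/-- The roots of the cubic are the values of ℘ at the three half-periods, where ℘' vanishes too. A
zero of ℘' at s would make s congruent to a half-period, which 0 < s < c/2 excludes. -/
lemma re_derivWeierstrassP_ne_zero {s : ℝ} (hs : s ∈ Ioo 0 (c / 2)) :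
    (L.derivWeierstrassP s).re ≠ 0 := by
  intro h
  have hs' := Ioo_subset_Ioc_self hs
  have hz := hL.ofReal_notMem hs'
  have hd : L.derivWeierstrassP s = 0 := by
    rw [← hL.ofReal_re_derivWeierstrassP, h, Complex.ofReal_zero]
  have hc := hL.pos
  obtain ⟨hs0, hs1⟩ := hs
  have h1 := L.derivWeierstrassP_sq s hz
  rw [hd, hL.g₂_eq, hL.g₃_eq_zero] at h1
  have h2 : L.weierstrassP s * ((L.weierstrassP s - L.weierstrassP (c / 2 : ℝ)) *
      (L.weierstrassP s + L.weierstrassP (c / 2 : ℝ))) = 0 := by linear_combination -h1 / 4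
  rcases mul_eq_zero.mp h2 with h3 | h3
  · refine hL.notMem_lattice_of_im ?_ ?_ (L.sub_mem_lattice_of_eq hL.diag_notMem hz
      (by rw [h3, hL.weierstrassP_diag]) (by rw [hd, hL.derivWeierstrassP_diag])) <;> simpa
  rcases mul_eq_zero.mp h3 with h3 | h3
  · refine hL.notMem_lattice_of_re ?_ ?_ (L.sub_mem_lattice_of_eq hL.half_notMem hz
      (sub_eq_zero.mp h3).symm (by rw [hd, hL.derivWeierstrassP_half]))
    · rw [Complex.sub_re, Complex.ofReal_re, Complex.ofReal_re]; linarith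
    · rw [Complex.sub_re, Complex.ofReal_re, Complex.ofReal_re]; linarith
  · refine hL.notMem_lattice_of_im ?_ ?_ (L.sub_mem_lattice_of_eq hL.I_mul_half_notMem hz
      (by rw [hL.weierstrassP_I_mul]; linear_combination -h3)
      (by rw [hd, hL.derivWeierstrassP_I_mul_half])) <;> simpa

omit hL in
lemma tendsto_re_weierstrassP :
    Tendsto (fun s : ℝ ↦ (L.weierstrassP s).re) (𝓝[>] 0) atTop := by
  have h1 : ContinuousAt (fun s : ℝ ↦ (L.weierstrassPExcept 0 s).re) 0 := by
    have h2 : ContinuousAt (fun s : ℝ ↦ L.weierstrassPExcept 0 s) 0 :=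
      ContinuousAt.comp (f := fun s : ℝ ↦ (s : ℂ)) (g := L.weierstrassPExcept 0)
        (by simpa using (L.analyticAt_weierstrassPExcept 0).continuousAt)
        Complex.continuous_ofReal.continuousAt
    exact Complex.continuous_re.continuousAt.comp h2
  have h2 : Tendsto (fun s : ℝ ↦ (s⁻¹) ^ 2) (𝓝[>] 0) atTop :=
    (tendsto_pow_atTop two_ne_zero).comp tendsto_inv_nhdsGT_zero
  refine ((h1.tendsto.mono_left nhdsWithin_le_nhds).add_atTop h2).congr fun s ↦ ?_
  rw [L.weierstrassP_eq_weierstrassPExcept 0 s]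
  have : ((1 : ℂ) / (s - (0 : L.lattice)) ^ 2 - 1 / ((0 : L.lattice) : ℂ) ^ 2) =
    (((s⁻¹) ^ 2 : ℝ) : ℂ) := by simp
  rw [this, Complex.add_re, Complex.ofReal_re]
  simp

omit hL in
lemma exists_gt_re_weierstrassP (y s : ℝ) (hs : 0 < s) :
    ∃ t ∈ Ioo 0 s, y < (L.weierstrassP t).re :=
  ((show ∀ᶠ t in 𝓝[>] (0 : ℝ), t ∈ Ioo 0 s from Ioo_mem_nhdsGT hs).and
    (tendsto_re_weierstrassP (L := L) |>.eventually_gt_atTop y)).exists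

lemma continuousOn_re_weierstrassP :
    ContinuousOn (fun s : ℝ ↦ (L.weierstrassP s).re) (Ioc 0 (c / 2)) :=
  fun _ hs ↦ (hL.hasDerivAt_re hs).continuousAt.continuousWithinAt

/-- A derivative without zeros on an interval has constant sign (Darboux), and a positive one
contradicts ℘(s) → +∞ as s → 0⁺. -/
lemma re_derivWeierstrassP_neg {s : ℝ} (hs : s ∈ Ioo 0 (c / 2)) :
    (L.derivWeierstrassP s).re < 0 := by
  rcases hasDerivWithinAt_forall_lt_or_forall_gt_of_forall_ne (convex_Ioo 0 (c / 2))
    (fun x hx ↦ (hL.hasDerivAt_re (Ioo_subset_Ioc_self hx)).hasDerivWithinAt)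
    (fun x hx ↦ hL.re_derivWeierstrassP_ne_zero hx) with h | h
  · exact h s hs
  · exfalso
    have hmono : StrictMonoOn (fun s : ℝ ↦ (L.weierstrassP s).re) (Ioo 0 (c / 2)) := by
      refine strictMonoOn_of_deriv_pos (convex_Ioo _ _)
        (hL.continuousOn_re_weierstrassP.mono Ioo_subset_Ioc_self) fun x hx ↦ ?_
      rw [interior_Ioo] at hx
      rw [(hL.hasDerivAt_re (Ioo_subset_Ioc_self hx)).deriv]
      exact h x hx
    obtain ⟨t, ht, hlt⟩ := exists_gt_re_weierstrassP (L := L) (L.weierstrassP s).re s hs.1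
    exact lt_asymm hlt (hmono ⟨ht.1, ht.2.trans hs.2⟩ hs ht.2)

lemma strictAntiOn_re_weierstrassP :
    StrictAntiOn (fun s : ℝ ↦ (L.weierstrassP s).re) (Ioc 0 (c / 2)) := by
  refine strictAntiOn_of_deriv_neg (convex_Ioc _ _) hL.continuousOn_re_weierstrassP fun x hx ↦ ?_
  rw [interior_Ioc] at hx
  rw [(hL.hasDerivAt_re (Ioo_subset_Ioc_self hx)).deriv]
  exact hL.re_derivWeierstrassP_neg hx

lemma half_mem_Ioc : c / 2 ∈ Ioc 0 (c / 2) := ⟨half_pos hL.pos, le_rfl⟩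

lemma image_re_weierstrassP :
    (fun s : ℝ ↦ (L.weierstrassP s).re) '' Ioo 0 (c / 2) = Ioi (L.weierstrassP (c / 2 : ℝ)).re := by
  apply Subset.antisymm
  · rintro _ ⟨s, hs, rfl⟩
    exact hL.strictAntiOn_re_weierstrassP (Ioo_subset_Ioc_self hs) hL.half_mem_Ioc hs.2
  · intro y hy
    obtain ⟨t, ht, hyt⟩ := exists_gt_re_weierstrassP (L := L) y _ (half_pos hL.pos)
    obtain ⟨s, hs, rfl⟩ := intermediate_value_Ioo' ht.2.le
      (hL.continuousOn_re_weierstrassP.mono (Icc_subset_Ioc_iff ht.2.le |>.mpr ⟨ht.1, le_rfl⟩))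
      ⟨hy, hyt⟩
    exact ⟨s, ⟨ht.1.trans hs.1, hs.2⟩, rfl⟩

/-- If e = ℘(c/2) were negative, ℘ would vanish somewhere on (0, c/2), and the cubic relation would
make ℘' vanish there too. -/
lemma re_weierstrassP_half_pos : 0 < (L.weierstrassP (c / 2 : ℝ)).re := by
  by_contra! h
  have hne : (L.weierstrassP (c / 2 : ℝ)).re ≠ 0 := fun h0 ↦ hL.weierstrassP_half_ne_zero <| by
    rw [← hL.ofReal_re_weierstrassP, h0, Complex.ofReal_zero]
  have h0 : (0 : ℝ) ∈ Ioi (L.weierstrassP (c / 2 : ℝ)).re := lt_of_le_of_ne h hne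
  rw [← hL.image_re_weierstrassP] at h0
  obtain ⟨s, hs, hs0⟩ := h0
  have hs0' : (L.weierstrassP s).re = 0 := hs0
  have := hL.re_derivWeierstrassP_sq (Ioo_subset_Ioc_self hs)
  rw [hs0', mul_zero, zero_mul] at this
  exact hL.re_derivWeierstrassP_ne_zero hs (pow_eq_zero_iff two_ne_zero |>.mp this)

/-- The half-period as a complete elliptic integral. -/
lemma agmIntegral_eq_half : agmIntegral (√(L.weierstrassP (c / 2 : ℝ)).re)
    (√(2 * (L.weierstrassP (c / 2 : ℝ)).re)) = c / 2 := by
  have epos := hL.re_weierstrassP_half_pos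
  have hsq := fun s (hs : s ∈ Ioo 0 (c / 2)) ↦ hL.re_derivWeierstrassP_sq (Ioo_subset_Ioc_self hs)
  have himage := hL.image_re_weierstrassP
  set e := (L.weierstrassP (c / 2 : ℝ)).re with he
  set f : ℝ → ℝ := fun s ↦ (L.weierstrassP s).re with hf
  -- The substitution t = √(℘(s) - e) gives t² + e = ℘ and t² + 2e = ℘ + e. Since |℘'| = 2t √(℘(℘ +
  -- e)), the integrand becomes 1, and the integral is the length of (0, c/2).
  set q : ℝ → ℝ := fun s ↦ √(f s - e) with hq
  have fgt : ∀ s ∈ Ioo 0 (c / 2), e < f s := fun s hs ↦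
    himage.subset (mem_image_of_mem f hs)
  have hder : ∀ s ∈ Ioo 0 (c / 2),
      HasDerivWithinAt q ((L.derivWeierstrassP s).re / (2 * √(f s - e))) (Ioo 0 (c / 2)) s := by
    intro s hs
    exact (((hL.hasDerivAt_re (Ioo_subset_Ioc_self hs)).sub_const e).sqrt
      (sub_pos.mpr (fgt s hs)).ne').hasDerivWithinAt
  have hinj : InjOn q (Ioo 0 (c / 2)) := by
    intro s hs t ht hst
    refine hL.strictAntiOn_re_weierstrassP.injOn (Ioo_subset_Ioc_self hs)
      (Ioo_subset_Ioc_self ht) ?_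
    have := (Real.sqrt_inj (sub_pos.mpr (fgt s hs)).le (sub_pos.mpr (fgt t ht)).le).mp hst
    simpa using this
  have himq : q '' Ioo 0 (c / 2) = Ioi 0 := by
    apply Subset.antisymm
    · rintro _ ⟨s, hs, rfl⟩
      exact Real.sqrt_pos.mpr (sub_pos.mpr (fgt s hs))
    · intro y hy
      have hy' : (0 : ℝ) < y := hy
      obtain ⟨s, hs, hsy⟩ := himage.symm.subset (show y ^ 2 + e ∈ Ioi e by simp; positivity)
      refine ⟨s, hs, ?_⟩
      have hsy' : f s = y ^ 2 + e := hsy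
      simp only [hq]
      rw [hsy', add_sub_cancel_right, Real.sqrt_sq hy'.le]
  have hcv := MeasureTheory.integral_image_eq_integral_abs_deriv_smul measurableSet_Ioo hder hinj
    (fun t ↦ (√((√e ^ 2 + t ^ 2) * (√(2 * e) ^ 2 + t ^ 2)))⁻¹)
  rw [himq] at hcv
  rw [agmIntegral, hcv]
  have hone : ∀ s ∈ Ioo 0 (c / 2), |(L.derivWeierstrassP s).re / (2 * √(f s - e))| •
      (√((√e ^ 2 + q s ^ 2) * (√(2 * e) ^ 2 + q s ^ 2)))⁻¹ = 1 := by
    intro s hs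
    have h1 := sub_pos.mpr (fgt s hs)
    have h2 : (L.derivWeierstrassP s).re ^ 2 = 4 * f s * ((f s - e) * (f s + e)) := hsq s hs
    have h3 : √((√e ^ 2 + q s ^ 2) * (√(2 * e) ^ 2 + q s ^ 2)) = √(f s * (f s + e)) := by
      simp only [hq]
      rw [Real.sq_sqrt epos.le, Real.sq_sqrt h1.le, Real.sq_sqrt (by positivity)]
      ring_nf
    have h4 : 0 < f s := epos.trans (fgt s hs)
    have h5 : |(L.derivWeierstrassP s).re| = 2 * √(f s - e) * √(f s * (f s + e)) := by
      rw [← Real.sqrt_sq_eq_abs, h2, mul_assoc (2 : ℝ), ← Real.sqrt_mul h1.le,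
        show 4 * f s * ((f s - e) * (f s + e)) = 2 ^ 2 * ((f s - e) * (f s * (f s + e))) by ring,
        Real.sqrt_mul (by norm_num), Real.sqrt_sq (by norm_num)]
    have h6 : 0 < √(f s - e) := Real.sqrt_pos.mpr h1
    have h7 : 0 < √(f s * (f s + e)) := Real.sqrt_pos.mpr (by positivity)
    rw [h3, abs_div, h5, abs_of_pos (by positivity : 0 < 2 * √(f s - e)), smul_eq_mul]
    field_simp
  rw [MeasureTheory.setIntegral_congr_fun measurableSet_Ioo hone]
  have := hL.pos
  simp; positivity

end IsSquareWithSide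

lemma isSquareWithSide_congruentPeriodPair (n : ℕ) (hn : 0 < n) :
    (congruentPeriodPair n hn).IsSquareWithSide (congruentPeriod n) :=
  ⟨congruentPeriod_pos hn, rfl, rfl⟩

/-- By homogeneity of the mean, c/2 = π / (2 √e M(√2, 1)); comparison with c = π / (√n M(√2, 1))
gives e = n. This is where the constant in the lattice is used. -/
lemma re_weierstrassP_half_congruentPeriodPair (n : ℕ) (hn : 0 < n) :
    ((congruentPeriodPair n hn).weierstrassP (congruentPeriod n / 2 : ℝ)).re = n := by
  have hL := isSquareWithSide_congruentPeriodPair n hn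
  have h := hL.agmIntegral_eq_half
  have epos := hL.re_weierstrassP_half_pos
  generalize ((congruentPeriodPair n hn).weierstrassP (congruentPeriod n / 2 : ℝ)).re = e at *
  have hn' : (0 : ℝ) < n := by exact_mod_cast hn
  have hM : (0 : ℝ) < NNReal.agm (NNReal.sqrt 2) 1 := NNReal.agm_pos (by simp) one_pos
  have hr : 0 < √e := Real.sqrt_pos.mpr epos
  have h2 : agmIntegral (√e) (√(2 * e)) = Real.pi / (2 * (√e * NNReal.agm (NNReal.sqrt 2) 1)) := by
    obtain ⟨r, hre⟩ : ∃ r : NNReal, (r : ℝ) = √e := ⟨⟨√e, hr.le⟩, rfl⟩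
    have hr0 : 0 < r := by rw [← NNReal.coe_pos, hre]; exact hr
    have h3 := agmIntegral_eq (a := r * NNReal.sqrt 2) (b := r * 1)
      (mul_pos hr0 (by simp)) (mul_pos hr0 (by simp))
    rw [NNReal.agm_mul_distrib, agmIntegral_comm] at h3
    have h4 : √(2 * e) = √e * √2 := by rw [mul_comm, Real.sqrt_mul epos.le]
    rw [h4]
    simpa [hre] using h3
  rw [h2, congruentPeriod, gaussConstant] at h
  have hsn : 0 < √(n : ℝ) := Real.sqrt_pos.mpr hn'
  have hpi := Real.pi_pos
  field_simp at h
  have h5 : √e = √(n : ℝ) := by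
    linarith
  exact (Real.sqrt_inj epos.le hn'.le).mp h5

lemma g₂_congruentPeriodPair (n : ℕ) (hn : 0 < n) :
    (congruentPeriodPair n hn).g₂ = 4 * (n : ℂ) ^ 2 := by
  have hL := isSquareWithSide_congruentPeriodPair n hn
  rw [hL.g₂_eq, ← hL.ofReal_re_weierstrassP, re_weierstrassP_half_congruentPeriodPair]
  norm_cast

lemma g₃_congruentPeriodPair (n : ℕ) (hn : 0 < n) : (congruentPeriodPair n hn).g₃ = 0 :=
  (isSquareWithSide_congruentPeriodPair n hn).g₃_eq_zero

end PeriodPair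

/-! ### The isomorphism of groups. -/

section CongruentPoint

open Filter Set WeierstrassCurve.Affine

variable {n : ℕ} (hn : 0 < n)

lemma congruentCurve_equation_iff (x y : ℂ) :
    (congruentCurve n).Equation x y ↔ y ^ 2 = x ^ 3 - (n : ℂ) ^ 2 * x := by
  rw [equation_iff]
  simp [congruentCurve, sub_eq_add_neg]

include hn in
lemma congruentCurve_nonsingular_of_equation {x y : ℂ} (h : (congruentCurve n).Equation x y) :
    (congruentCurve n).Nonsingular x y := by
  have := congruentCurve_isElliptic hn
  exact equation_iff_nonsingular.mp h

lemma derivWeierstrassP_congruentPeriodPair_sq {z : ℂ}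
    (hz : z ∉ (congruentPeriodPair n hn).lattice) :
    (congruentPeriodPair n hn).derivWeierstrassP z ^ 2 =
      4 * (congruentPeriodPair n hn).weierstrassP z ^ 3 -
        4 * (n : ℂ) ^ 2 * (congruentPeriodPair n hn).weierstrassP z := by
  rw [(congruentPeriodPair n hn).derivWeierstrassP_sq z hz,
    PeriodPair.g₂_congruentPeriodPair, PeriodPair.g₃_congruentPeriodPair, sub_zero]

lemma nonsingular_weierstrassP {z : ℂ} (hz : z ∉ (congruentPeriodPair n hn).lattice) :
    (congruentCurve n).Nonsingular ((congruentPeriodPair n hn).weierstrassP z)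
      ((congruentPeriodPair n hn).derivWeierstrassP z / 2) := by
  refine congruentCurve_nonsingular_of_equation hn ((congruentCurve_equation_iff _ _).mpr ?_)
  linear_combination derivWeierstrassP_congruentPeriodPair_sq hn hz / 4

open Classical in
/-- The uniformization `z ↦ (℘ z, ℘' z / 2)` of `y² = x³ - n² x`. -/
noncomputable def congruentPoint (z : ℂ) : (congruentCurve n).Point :=
  if hz : z ∈ (congruentPeriodPair n hn).lattice then 0
  else .some _ _ (nonsingular_weierstrassP hn hz)

lemma congruentPoint_of_mem {z : ℂ} (hz : z ∈ (congruentPeriodPair n hn).lattice) :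
    congruentPoint hn z = 0 := dif_pos hz

lemma congruentPoint_of_notMem {z : ℂ} (hz : z ∉ (congruentPeriodPair n hn).lattice) :
    congruentPoint hn z = .some _ _ (nonsingular_weierstrassP hn hz) := dif_neg hz

lemma congruentPoint_eq_zero_iff {z : ℂ} :
    congruentPoint hn z = 0 ↔ z ∈ (congruentPeriodPair n hn).lattice := by
  refine ⟨fun h ↦ ?_, congruentPoint_of_mem hn⟩
  by_contra hz
  rw [congruentPoint_of_notMem hn hz] at h
  exact Point.some_ne_zero _ h

lemma congruentPoint_add_of_mem (z : ℂ) {l : ℂ} (hl : l ∈ (congruentPeriodPair n hn).lattice) :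
    congruentPoint hn (z + l) = congruentPoint hn z := by
  by_cases hz : z ∈ (congruentPeriodPair n hn).lattice
  · rw [congruentPoint_of_mem hn hz, congruentPoint_of_mem hn (add_mem hz hl)]
  · have hzl : z + l ∉ (congruentPeriodPair n hn).lattice := by
      rwa [Submodule.add_mem_iff_left _ hl]
    rw [congruentPoint_of_notMem hn hz, congruentPoint_of_notMem hn hzl, Point.some.injEq]
    exact ⟨(congruentPeriodPair n hn).weierstrassP_add_coe z ⟨l, hl⟩,
      congrArg (· / 2) ((congruentPeriodPair n hn).derivWeierstrassP_add_coe z ⟨l, hl⟩)⟩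

lemma congruentPoint_neg (z : ℂ) : congruentPoint hn (-z) = -congruentPoint hn z := by
  by_cases hz : z ∈ (congruentPeriodPair n hn).lattice
  · rw [congruentPoint_of_mem hn hz, congruentPoint_of_mem hn (neg_mem hz), neg_zero]
  · rw [congruentPoint_of_notMem hn hz, congruentPoint_of_notMem hn (mt neg_mem_iff.mp hz),
      Point.neg_some, Point.some.injEq]
    simp [negY, congruentCurve, neg_div]

/-- The chord law is the pair of addition formulas; as y = ℘'/2, the slope is λ/2, whence the λ²/4.
-/
lemma congruentPoint_add_of_ne {z w : ℂ} (hz : z ∉ (congruentPeriodPair n hn).lattice)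
    (hw : w ∉ (congruentPeriodPair n hn).lattice) (hzw : z + w ∉ (congruentPeriodPair n hn).lattice)
    (hne : (congruentPeriodPair n hn).weierstrassP z ≠ (congruentPeriodPair n hn).weierstrassP w) :
    congruentPoint hn (z + w) = congruentPoint hn z + congruentPoint hn w := by
  have hne' := sub_ne_zero.mpr hne
  have h1 := (congruentPeriodPair n hn).weierstrassP_add hz hw hzw
  have h2 := (congruentPeriodPair n hn).derivWeierstrassP_add hz hw hzw hne
  rw [congruentPoint_of_notMem hn hz, congruentPoint_of_notMem hn hw,
    congruentPoint_of_notMem hn hzw, Point.add_of_X_ne hne, Point.some.injEq]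
  have hX : (congruentPeriodPair n hn).weierstrassP (z + w) = (congruentCurve n).addX
      ((congruentPeriodPair n hn).weierstrassP z) ((congruentPeriodPair n hn).weierstrassP w)
      ((congruentCurve n).slope
        ((congruentPeriodPair n hn).weierstrassP z) ((congruentPeriodPair n hn).weierstrassP w)
        ((congruentPeriodPair n hn).derivWeierstrassP z / 2)
        ((congruentPeriodPair n hn).derivWeierstrassP w / 2)) := by
    rw [slope_of_X_ne hne, addX]
    simp only [congruentCurve]
    field_simp
    linear_combination -h1
  refine ⟨hX, ?_⟩
  rw [addY, negAddY, ← hX, slope_of_X_ne hne, h2, negY]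
  simp only [congruentCurve]
  field_simp
  ring

lemma PeriodPair.eventually_weierstrassP_ne (L : PeriodPair) {z : ℂ} (hz : z ∉ L.lattice) (a : ℂ) :
    ∀ᶠ u in 𝓝[≠] z, L.weierstrassP u ≠ a := by
  refine ((L.analyticAt_weierstrassP hz).eventually_eq_or_eventually_ne
    analyticAt_const).resolve_left fun h ↦ L.not_eqOn_weierstrassP_const a ?_
  exact L.analyticOnNhd_weierstrassP.eqOn_of_preconnected_of_eventuallyEq analyticOnNhd_const
    L.isPreconnected_compl_lattice hz h

/-- Periodicity and oddness settle the cases that involve Λ. In the others, three chord additions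
for a generic u suffice and u cancels, so the tangent law is never needed, even for doubling. -/
lemma congruentPoint_add (z w : ℂ) :
    congruentPoint hn (z + w) = congruentPoint hn z + congruentPoint hn w := by
  by_cases hz : z ∈ (congruentPeriodPair n hn).lattice
  · rw [add_comm z, congruentPoint_add_of_mem hn w hz, congruentPoint_of_mem hn hz, zero_add]
  by_cases hw : w ∈ (congruentPeriodPair n hn).lattice
  · rw [congruentPoint_add_of_mem hn z hw, congruentPoint_of_mem hn hw, add_zero]
  by_cases hzw : z + w ∈ (congruentPeriodPair n hn).lattice
  · have := congruentPoint_add_of_mem hn (-z) hzw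
    rw [neg_add_cancel_left, congruentPoint_neg] at this
    rw [this, congruentPoint_of_mem hn hzw, add_neg_cancel]
  -- reduce to generic sums via `z + w = (z + u) + (w - u)` with `u = t - z` and `t` close to `0`
  have hnz : -z ∉ (congruentPeriodPair n hn).lattice := mt neg_mem_iff.mp hz
  have hshift : Tendsto (fun t : ℂ ↦ t - z) (𝓝[≠] 0) (𝓝[≠] (-z)) := by
    refine tendsto_nhdsWithin_iff.mpr ⟨?_, ?_⟩
    · have : ContinuousAt (fun t : ℂ ↦ t - z) 0 := by fun_prop
      simpa using this.tendsto.mono_left nhdsWithin_le_nhds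
    · filter_upwards [self_mem_nhdsWithin] with t ht h
      exact ht (by simpa [sub_eq_neg_add] using h)
  obtain ⟨t, ⟨ht, hct, htne, -⟩, hu, huz, huw⟩ :=
    (((congruentPeriodPair n hn).eventually_chordX hzw).and
      ((hshift.eventually ((congruentPeriodPair n hn).eventually_notMem_lattice (-z))).and
      ((hshift.eventually ((congruentPeriodPair n hn).eventually_weierstrassP_ne hnz
        ((congruentPeriodPair n hn).weierstrassP z))).and
      (hshift.eventually ((congruentPeriodPair n hn).eventually_weierstrassP_ne hnz
        ((congruentPeriodPair n hn).weierstrassP w)))))).exists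
  obtain ⟨u, rfl⟩ : ∃ u, t = z + u := ⟨t - z, by ring⟩
  rw [add_sub_cancel_left] at hu huz huw
  have e : z + w - (z + u) = w + -u := by ring
  rw [e] at hct htne
  have h1 := congruentPoint_add_of_ne hn ht hct (by rwa [show z + u + (w + -u) = z + w by ring]) htne
  rw [congruentPoint_add_of_ne hn hz hu ht huz.symm, congruentPoint_add_of_ne hn hw
    (mt neg_mem_iff.mp hu) hct (by rw [PeriodPair.weierstrassP_neg]; exact huw.symm),
    congruentPoint_neg, show z + u + (w + -u) = z + w by ring] at h1
  rw [h1]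
  abel

/-- `congruentPoint` as a homomorphism. -/
noncomputable def congruentPointHom : ℂ →+ (congruentCurve n).Point where
  toFun := congruentPoint hn
  map_zero' := congruentPoint_of_mem hn (zero_mem _)
  map_add' := congruentPoint_add hn

lemma congruentPointHom_ker : (congruentPointHom hn).ker = congruentLattice n := by
  rw [← congruentPeriodPair_lattice n hn]
  ext z
  exact congruentPoint_eq_zero_iff hn

lemma congruentPointHom_surjective : Function.Surjective (congruentPointHom hn) := by
  rintro (_ | ⟨x, y, h⟩)
  · exact ⟨0, map_zero _⟩
  · obtain ⟨z, hz, rfl⟩ := (congruentPeriodPair n hn).exists_weierstrassP_eq x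
    have h1 := (congruentCurve_equation_iff _ _).mp h.1
    have h2 := derivWeierstrassP_congruentPeriodPair_sq hn hz
    have h3 : y ^ 2 = ((congruentPeriodPair n hn).derivWeierstrassP z / 2) ^ 2 := by
      linear_combination h1 - h2 / 4
    -- The two points above x have parameters z and -z, because ℘ is even and ℘' is odd.
    rcases sq_eq_sq_iff_eq_or_eq_neg.mp h3 with rfl | rfl
    · exact ⟨z, congruentPoint_of_notMem hn hz⟩
    · refine ⟨-z, (congruentPoint_of_notMem hn (mt neg_mem_iff.mp hz)).trans ?_⟩
      rw [Point.some.injEq]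
      simp [neg_div]

/-- The isomorphism of groups `ℂ / Λ ≃ E(ℂ)`. -/
noncomputable def congruentEquiv : (ℂ ⧸ congruentLattice n) ≃+ (congruentCurve n).Point :=
  QuotientAddGroup.liftEquiv (congruentLattice n) (congruentPointHom_surjective hn)
    (congruentPointHom_ker hn).symm

end CongruentPoint

/-! ### Topology of the projective plane and of the curve. -/

open Filter Set

lemma AnalyticAt.exists_analyticAt_leftInverse {q : ℂ → ℂ} {z₀ : ℂ} (hq : AnalyticAt ℂ q z₀)
    (hq' : deriv q z₀ ≠ 0) : ∃ ψ : ℂ → ℂ, AnalyticAt ℂ ψ (q z₀) ∧ ∀ᶠ z in 𝓝 z₀, ψ (q z) = z :=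
  ⟨_, hq.analyticAt_localInverse hq', HasStrictFDerivAt.eventually_left_inverse _⟩

namespace ProjPlane

lemma tendsto_mk {α : Type*} {l : Filter α} {f : α → ProjPlane} {v : α → Fin 3 → ℂ}
    {v₀ : Fin 3 → ℂ} (h₀ : v₀ ≠ 0) (hv : Tendsto v l (𝓝 v₀))
    (hf : ∀ᶠ a in l, ∃ h : v a ≠ 0, f a = Projectivization.mk ℂ (v a) h) :
    Tendsto f l (𝓝 (Projectivization.mk ℂ v₀ h₀)) := by
  rw [tendsto_nhds]
  intro s hs hmem
  obtain ⟨t, ht, hts⟩ := isOpen_induced_iff.mp (isOpen_coinduced.mp hs)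
  have h₀t : v₀ ∈ t := by
    have : (⟨v₀, h₀⟩ : {v : Fin 3 → ℂ // v ≠ 0}) ∈ Subtype.val ⁻¹' t := by
      rw [hts]; exact hmem
    exact this
  filter_upwards [hf, hv.eventually (ht.mem_nhds h₀t)] with a ⟨ha, hfa⟩ hat
  have : (⟨v a, ha⟩ : {v : Fin 3 → ℂ // v ≠ 0}) ∈ Subtype.val ⁻¹' t := hat
  rw [hts] at this
  rw [mem_preimage, hfa]
  exact this

/-- A function of homogeneous coordinates that is invariant under scaling can be computed from any
representative. -/
lemma comp_rep_eq {α : Type*} {h : (Fin 3 → ℂ) → α} (hh : ∀ (a : ℂ) (w), a ≠ 0 → h (a • w) = h w)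
    (w : Fin 3 → ℂ) (hw : w ≠ 0) : h (Projectivization.mk ℂ w hw).rep = h w := by
  obtain ⟨a, ha⟩ := Projectivization.exists_smul_eq_mk_rep ℂ w hw
  rw [← ha]
  exact hh a w a.ne_zero

lemma exists_minor_ne_zero {v w : Fin 3 → ℂ} (hv : v ≠ 0) (hw : w ≠ 0)
    (hne : Projectivization.mk ℂ v hv ≠ Projectivization.mk ℂ w hw) :
    ∃ i j, v i * w j - v j * w i ≠ 0 := by
  by_contra! h
  obtain ⟨i, hi⟩ := Function.ne_iff.mp hw
  refine hne ((Projectivization.mk_eq_mk_iff' ℂ v w hv hw).mpr ⟨v i / w i, ?_⟩)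
  ext j
  have := h i j
  have hi' : w i ≠ 0 := hi
  simp only [Pi.smul_apply, smul_eq_mul]
  field_simp
  linear_combination this

/-- The size of a 2 × 2 minor against v, divided by ‖w‖, is invariant under scaling of w; it
vanishes at [v], and a suitable minor does not vanish at [u]. -/
instance : T2Space ProjPlane := by
  refine ⟨fun p q hpq ↦ ?_⟩
  induction p using Projectivization.ind with | h v hv => ?_
  induction q using Projectivization.ind with | h u hu => ?_
  obtain ⟨i, j, hij⟩ := exists_minor_ne_zero hv hu hpq
  set F : (Fin 3 → ℂ) → ℝ := fun w ↦ ‖v i * w j - v j * w i‖ / ‖w‖ with hF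
  have hinv : ∀ (a : ℂ) (w), a ≠ 0 → F (a • w) = F w := by
    intro a w ha
    have h1 : v i * (a * w j) - v j * (a * w i) = a * (v i * w j - v j * w i) := by ring
    simp only [hF, Pi.smul_apply, smul_eq_mul, norm_smul, h1, norm_mul]
    exact mul_div_mul_left _ _ (norm_ne_zero_iff.mpr ha)
  refine separated_by_continuous (f := fun x : ProjPlane ↦ F x.rep) ?_ ?_
  · refine continuous_coinduced_dom.mpr ?_
    have heq : (fun x : ProjPlane ↦ F x.rep) ∘
        (Projectivization.mk' ℂ : {v : Fin 3 → ℂ // v ≠ 0} → ProjPlane) = fun w ↦ F w.1 :=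
      funext fun w ↦ comp_rep_eq hinv w.1 w.2
    rw [heq]
    refine Continuous.div ?_ ?_ fun w ↦ norm_ne_zero_iff.mpr w.2
    · have (k : Fin 3) : Continuous fun w : {v : Fin 3 → ℂ // v ≠ 0} ↦ w.1 k :=
        (continuous_apply k).comp continuous_subtype_val
      exact ((continuous_const.mul (this j)).sub (continuous_const.mul (this i))).norm
    · fun_prop
  · rw [comp_rep_eq hinv, comp_rep_eq hinv]
    have h0 : F v = 0 := by simp [hF, mul_comm]
    rw [h0]
    exact (div_pos (norm_pos_iff.mpr hij) (norm_pos_iff.mpr hu)).ne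

end ProjPlane

namespace WeierstrassCurve.Affine.Point

variable {W : WeierstrassCurve.Affine ℂ}

lemma toPlane_injective : Function.Injective (toPlane (W := W)) := by
  rintro (_ | ⟨x, y, h⟩) (_ | ⟨x', y', h'⟩) heq
  · rfl
  · obtain ⟨a, ha⟩ := (Projectivization.mk_eq_mk_iff' ℂ _ _ _ _).mp heq
    have h1 := congrFun ha 1
    have h2 := congrFun ha 2
    simp at h1 h2
    simp [h2] at h1
  · obtain ⟨a, ha⟩ := (Projectivization.mk_eq_mk_iff' ℂ _ _ _ _).mp heq
    have h2 := congrFun ha 2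
    simp at h2
  · obtain ⟨a, ha⟩ := (Projectivization.mk_eq_mk_iff' ℂ _ _ _ _).mp heq
    have h0 := congrFun ha 0
    have h1 := congrFun ha 1
    have h2 := congrFun ha 2
    simp at h0 h1 h2
    subst h2
    simp at h0 h1
    subst h0 h1
    rfl

lemma continuous_toPlane : Continuous (toPlane (W := W)) := continuous_induced_dom

instance : T2Space W.Point := .of_injective_continuous toPlane_injective continuous_toPlane

end WeierstrassCurve.Affine.Point

/-! ### Biholomorphy. -/

section Uniformization

open WeierstrassCurve.Affine

variable {n : ℕ} (hn : 0 < n)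

/-- Where ℘' = 0, ℘ is a root of x³ - n²x, and ℘'' = 2(3℘² - n²) is nonzero because the roots are
simple. So ℘' is a local parameter where ℘ is not. -/
lemma deriv_derivWeierstrassP_ne_zero {z : ℂ} (hz : z ∉ (congruentPeriodPair n hn).lattice)
    (h : (congruentPeriodPair n hn).derivWeierstrassP z = 0) :
    deriv (congruentPeriodPair n hn).derivWeierstrassP z ≠ 0 := by
  have hn0 : (n : ℂ) ^ 2 ≠ 0 := pow_ne_zero 2 (by exact_mod_cast hn.ne')
  have h1 := derivWeierstrassP_congruentPeriodPair_sq hn hz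
  rw [((congruentPeriodPair n hn).hasDerivAt_derivWeierstrassP hz).deriv,
    PeriodPair.g₂_congruentPeriodPair]
  rw [h] at h1
  generalize (congruentPeriodPair n hn).weierstrassP z = X at *
  have h2 : X * (X ^ 2 - (n : ℂ) ^ 2) = 0 := by linear_combination -h1 / 4
  intro h3
  rcases mul_eq_zero.mp h2 with rfl | h4
  · exact hn0 (by linear_combination -h3 / 2)
  · exact hn0 (by linear_combination h3 / 4 - 3 / 2 * h4)

/-- Locally `congruentPoint` lifts to an analytic map to `ℂ³`, and one of the affine coordinates of
the lift is a local coordinate. -/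
lemma exists_analyticAt_lift (z₀ : ℂ) : ∃ V : ℂ → Fin 3 → ℂ, AnalyticAt ℂ V z₀ ∧
    (∀ᶠ z in 𝓝 z₀, ∃ h : V z ≠ 0, (congruentPoint hn z).toPlane = Projectivization.mk ℂ (V z) h) ∧
    ∃ i j, V z₀ j ≠ 0 ∧ deriv (fun z ↦ V z i / V z j) z₀ ≠ 0 := by
  set L := congruentPeriodPair n hn with hL
  by_cases hz : z₀ ∈ L.lattice
  · set e := L.weierstrassPExcept z₀ with he
    set b := L.derivWeierstrassPExcept z₀ with hb
    have ea : AnalyticAt ℂ e z₀ := L.analyticAt_weierstrassPExcept z₀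
    have ba : AnalyticAt ℂ b z₀ := L.analyticAt_derivWeierstrassPExcept z₀
    -- This is (℘, ℘'/2, 1) times (z - z₀)³, which clears the poles; the value at z₀ is (0, -1, 0)
    -- and x/y has derivative -1 there. For z₀ = 0 the term 1/z₀² is 0, as in the series of ℘.
    refine ⟨fun z ↦ ![(z - z₀) + (z - z₀) ^ 3 * (e z - 1 / z₀ ^ 2),
      -1 + (z - z₀) ^ 3 * b z / 2, (z - z₀) ^ 3], ?_, ?_, 0, 1, by simp, ?_⟩
    · refine analyticAt_pi_iff.mpr fun i ↦ ?_
      fin_cases i <;> simp <;> fun_prop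
    · have hmem : ∀ᶠ z in 𝓝 z₀, z ≠ z₀ → z ∉ L.lattice :=
        eventually_nhdsWithin_iff.mp (L.eventually_notMem_lattice z₀)
      filter_upwards [hmem] with z hzL
      by_cases hzz : z = z₀
      · subst hzz
        refine ⟨fun h ↦ by simpa using congrFun h 1, ?_⟩
        rw [congruentPoint_of_mem hn hz]
        refine (Projectivization.mk_eq_mk_iff' ℂ _ _ _ _).mpr ⟨-1, ?_⟩
        ext i
        fin_cases i <;> simp
      · have hs : z - z₀ ≠ 0 := sub_ne_zero.mpr hzz
        refine ⟨fun h ↦ hs (by simpa using congrFun h 2), ?_⟩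
        rw [congruentPoint_of_notMem hn (hzL hzz)]
        refine (Projectivization.mk_eq_mk_iff' ℂ _ _ _ _).mpr ⟨((z - z₀) ^ 3)⁻¹, ?_⟩
        have e1 : L.weierstrassP z = e z + (1 / (z - z₀) ^ 2 - 1 / z₀ ^ 2) :=
          L.weierstrassP_eq_weierstrassPExcept ⟨z₀, hz⟩ z
        have e2 : L.derivWeierstrassP z = b z - 2 / (z - z₀) ^ 3 :=
          L.derivWeierstrassP_eq_derivWeierstrassPExcept ⟨z₀, hz⟩ z
        ext i
        fin_cases i
        · simp only [Fin.zero_eta, Pi.smul_apply, Matrix.cons_val_zero, smul_eq_mul, ← hL, e1]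
          generalize 1 / z₀ ^ 2 = k
          field_simp
          ring
        · simp only [Fin.mk_one, Pi.smul_apply, Matrix.cons_val_one, Matrix.cons_val_zero,
            smul_eq_mul, ← hL, e2]
          field_simp
          ring
        · simp [hs]
    · have h1 : HasDerivAt (fun z ↦ (z - z₀) + (z - z₀) ^ 3 * (e z - 1 / z₀ ^ 2)) 1 z₀ := by
        have h2 : HasDerivAt (fun z : ℂ ↦ z - z₀) 1 z₀ := (hasDerivAt_id z₀).sub_const z₀
        have h3 := h2.fun_add ((h2.fun_pow 3).fun_mul
          (ea.differentiableAt.hasDerivAt.sub_const (1 / z₀ ^ 2)))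
        refine h3.congr_deriv ?_
        simp
      have h2 : HasDerivAt (fun z ↦ -1 + (z - z₀) ^ 3 * b z / 2)
          (deriv (fun z ↦ -1 + (z - z₀) ^ 3 * b z / 2) z₀) z₀ := by
        refine DifferentiableAt.hasDerivAt ?_
        have := ba.differentiableAt
        fun_prop
      have h3 := h1.fun_div h2 (by simp)
      simp only [Matrix.cons_val_zero, Matrix.cons_val_one]
      rw [h3.deriv]
      simp
  · refine ⟨fun z ↦ ![L.weierstrassP z, L.derivWeierstrassP z / 2, 1], ?_, ?_, ?_⟩
    · have h1 := L.analyticAt_weierstrassP hz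
      have h2 := L.analyticAt_derivWeierstrassP hz
      refine analyticAt_pi_iff.mpr fun i ↦ ?_
      fin_cases i <;> simp <;> fun_prop
    · filter_upwards [L.isOpen_compl_lattice.mem_nhds hz] with z hz
      refine ⟨fun h ↦ by simpa using congrFun h 2, ?_⟩
      rw [congruentPoint_of_notMem hn hz]
      rfl
    · by_cases hd : L.derivWeierstrassP z₀ = 0
      · refine ⟨1, 2, by simp, ?_⟩
        simpa using deriv_derivWeierstrassP_ne_zero hn hz hd
      · refine ⟨0, 2, by simp, ?_⟩
        simpa using hd

lemma continuous_congruentPoint : Continuous (congruentPoint hn) := by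
  refine continuous_induced_rng.mpr (continuous_iff_continuousAt.mpr fun z ↦ ?_)
  obtain ⟨V, hV, hVp, -⟩ := exists_analyticAt_lift hn z
  obtain ⟨h0, h1⟩ := hVp.self_of_nhds
  rw [ContinuousAt, Function.comp_apply, h1]
  exact ProjPlane.tendsto_mk h0 hV.continuousAt hVp

include hn in
lemma compactSpace_quotient_congruentLattice : CompactSpace (ℂ ⧸ congruentLattice n) := by
  have h := IsZLattice.isCompact_range_of_periodic (congruentPeriodPair n hn).lattice
    (fun z : ℂ ↦ (z : ℂ ⧸ congruentLattice n)) continuous_quotient_mk' (fun z w hw ↦ by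
      refine QuotientAddGroup.eq.mpr ?_
      rw [← congruentPeriodPair_lattice n hn, neg_add_rev, neg_add_cancel_right]
      exact neg_mem hw)
  rw [Set.range_eq_univ.mpr (QuotientAddGroup.mk_surjective)] at h
  exact ⟨h⟩

lemma continuous_congruentEquiv : Continuous (congruentEquiv hn) :=
  continuous_quot_lift _ (continuous_congruentPoint hn)

/-- A continuous bijection from a compact space to a Hausdorff space. -/
lemma isHomeomorph_congruentEquiv : IsHomeomorph (congruentEquiv hn) := by
  have := compactSpace_quotient_congruentLattice hn
  exact isHomeomorph_iff_continuous_bijective.mpr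
    ⟨continuous_congruentEquiv hn, (congruentEquiv hn).bijective⟩

/-- Turns statements near a point of the curve into statements near a parameter z. -/
lemma map_congruentPoint_nhds (z : ℂ) :
    map (congruentPoint hn) (𝓝 z) = 𝓝 (congruentPoint hn z) :=
  ((isHomeomorph_congruentEquiv hn).isOpenMap.comp
    (QuotientAddGroup.isOpenMap_coe)).map_nhds_eq (continuous_congruentPoint hn).continuousAt

lemma analyticAt_of_holomorphicAt {g : (congruentCurve n).Point → ℂ} {z : ℂ}
    (hg : Point.HolomorphicAt g (congruentPoint hn z)) :
    AnalyticAt ℂ (fun w ↦ g (congruentPoint hn w)) z := by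
  obtain ⟨F, hF, hgF⟩ := hg
  obtain ⟨V, hV, hVp, -⟩ := exists_analyticAt_lift hn z
  obtain ⟨h0, h1⟩ := hVp.self_of_nhds
  refine ((hF (V z) h0 h1.symm).fun_comp hV).congr ?_
  filter_upwards [hVp, (continuous_congruentPoint hn).continuousAt.eventually hgF] with w
    ⟨hw0, hw⟩ hgw
  rw [hgw, hw, dif_pos hw0]

/-- With ψ a local inverse of the parameter V i / V j, the function x ↦ f(ψ(x i / x j)) is
homogeneous of degree 0, is analytic at the point, and restricts to g on the curve nearby. -/
lemma holomorphicAt_of_analyticAt {g : (congruentCurve n).Point → ℂ} {z : ℂ}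
    (hg : AnalyticAt ℂ (fun w ↦ g (congruentPoint hn w)) z) :
    Point.HolomorphicAt g (congruentPoint hn z) := by
  obtain ⟨V, hV, hVp, i, j, hj, hderiv⟩ := exists_analyticAt_lift hn z
  have hcoord (k : Fin 3) : AnalyticAt ℂ (fun w ↦ V w k) z := analyticAt_pi_iff.mp hV k
  obtain ⟨ψ, hψ, hψq⟩ :=
    ((hcoord i).fun_div (hcoord j) hj).exists_analyticAt_leftInverse hderiv
  set f : ℂ → ℂ := fun w ↦ g (congruentPoint hn w) with hf
  have hψz : ψ (V z i / V z j) = z := hψq.self_of_nhds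
  have hinv : ∀ (a : ℂ) (w : Fin 3 → ℂ), a ≠ 0 →
      f (ψ ((a • w) i / (a • w) j)) = f (ψ (w i / w j)) := by
    intro a w ha
    simp only [Pi.smul_apply, smul_eq_mul, mul_div_mul_left _ _ ha]
  refine ⟨fun x ↦ f (ψ (x.rep i / x.rep j)), ?_, ?_⟩
  · intro v hv hvp
    obtain ⟨h0, h1⟩ := hVp.self_of_nhds
    rw [h1] at hvp
    obtain ⟨a, rfl⟩ := (Projectivization.mk_eq_mk_iff' ℂ _ _ _ _).mp hvp
    have ha : a ≠ 0 := by
      rintro rfl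
      simp at hv
    have hratio : (a • V z) i / (a • V z) j = V z i / V z j := by
      simp only [Pi.smul_apply, smul_eq_mul, mul_div_mul_left _ _ ha]
    have hden : (a • V z) j ≠ 0 := by simpa using ⟨ha, hj⟩
    have hq : AnalyticAt ℂ (fun w : Fin 3 → ℂ ↦ w i / w j) (a • V z) :=
      ((ContinuousLinearMap.proj (R := ℂ) (φ := fun _ : Fin 3 ↦ ℂ) i).analyticAt _).fun_div
        ((ContinuousLinearMap.proj (R := ℂ) (φ := fun _ : Fin 3 ↦ ℂ) j).analyticAt _) hden
    have hfψ : AnalyticAt ℂ (fun x ↦ f (ψ x)) (V z i / V z j) := hg.fun_comp_of_eq hψ hψz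
    refine (hfψ.fun_comp_of_eq hq hratio).congr ?_
    filter_upwards [isOpen_ne.mem_nhds hv] with w hw
    rw [dif_pos hw]
    exact (ProjPlane.comp_rep_eq (h := fun w ↦ f (ψ (w i / w j))) hinv w hw).symm
  · rw [← map_congruentPoint_nhds hn z]
    change ∀ᶠ w in 𝓝 z, _
    filter_upwards [hVp, hψq] with w ⟨hw0, hw⟩ hψw
    rw [hw, ProjPlane.comp_rep_eq (h := fun w ↦ f (ψ (w i / w j))) hinv _ hw0, hψw]

lemma isBiholomorphic_congruentEquiv : IsBiholomorphic (congruentEquiv hn) where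
  isHomeomorph := isHomeomorph_congruentEquiv hn
  holomorphicAt_iff g p := by
    refine ⟨?_, fun h ↦ ?_⟩
    · rintro h z rfl
      exact analyticAt_of_holomorphicAt hn h
    · obtain ⟨z, rfl⟩ := QuotientAddGroup.mk_surjective p
      exact holomorphicAt_of_analyticAt hn (h z rfl)

end Uniformization

theorem theorem4p3 (n : ℕ) (hn : 0 < n) :
    ∃ φ : (ℂ ⧸ congruentLattice n) ≃+ (congruentCurve n).Point,
      IsBiholomorphic φ ∧
      ∀ z : ℂ, z ∉ congruentLattice n →
        ∃ h : (congruentCurve n).Nonsingular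
            ((congruentPeriodPair n hn).weierstrassP z)
            ((congruentPeriodPair n hn).derivWeierstrassP z / 2),
          φ (z : ℂ ⧸ congruentLattice n) =
            WeierstrassCurve.Affine.Point.some
              ((congruentPeriodPair n hn).weierstrassP z)
              ((congruentPeriodPair n hn).derivWeierstrassP z / 2) h := by
  refine ⟨congruentEquiv hn, isBiholomorphic_congruentEquiv hn, fun z hz ↦ ?_⟩
  rw [← congruentPeriodPair_lattice n hn] at hz
  exact ⟨nonsingular_weierstrassP hn hz, congruentPoint_of_notMem hn hz⟩
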